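/- Let $m\ge 1$ and $\alpha\ge m$ be integers and let $M=(M_{i,j})_{i,j=0}^{m-1}$ be a real $m\times m$ matrix. Consider on real polynomials the discrete Laguerre--Sobolev bilinear form $$\langle p,q\rangle=\int_0^\infty p(x)q(x)x^{\alpha-m}e^{-x}\,dx+\sum_{i,j=0}^{m-1}p^{(i)}(0)M_{i,j}q^{(j)}(0).$$ For $l=1,\dots,m$ let $\mathcal R_l$ be the polynomial $$\mathcal R_l(x)=\frac{(\alpha-m+l-1)!}{(m-l)!}(x+1)_{m-l}+(l-1)!\,(x+1)_\alpha\sum_{i=0}^{m-1}\frac{(-1)^iM_{l-1,i}}{(\alpha+i)!}(x-i+1)_i,$$ where $(y)_k=y(y+1)\cdots(y+k-1)$, and let $\Omega(x)=\det(\mathcal R_i(x-j))_{i,j=1}^m$. With the Laguerre polynomials $L_n^\alpha(x)=\sum_{j=0}^n\frac{(-x)^j}{j!}\binom{n+\alpha}{n-j}$ ($L_n^\alpha=0$ for $n<0$), let $q_n$, $n\ge0$, be the discrete Laguerre--Sobolev polynomial given by the $(m+1)\times(m+1)$ determinant whose first row is $(L_n^\alpha(x),L_{n-1}^\alpha(x),\dots,L_{n-m}^\alpha(x))$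 and whose $(i+1)$-st row is $(\mathcal R_i(n),\mathcal R_i(n-1),\dots,\mathcal R_i(n-m))$, $i=1,\dots,m$. The $\alpha$-weighted rank of $M$ is $$\operatorname{awr}(M)=\sum_{j=1}^m n_j+\sum_{j=1}^{m-1}m_j-\frac{m(m-1)}2,$$ where, with $c_1,\dots,c_m$ the columns of $M$, $n_j=\alpha+m-j$ if $c_{m-j+1}\notin\langle c_{m-j+2},\dots,c_m\rangle$ and $n_j=0$ otherwise; and, with $f_1,\dots,f_m$ the rows of the matrix $\tilde M$ formed by those columns $c_i$ of $M$ with $c_i\notin\langle c_{i+1},\dots,c_m\rangle$, $m_j=m-j$ if $f_j\in\langle f_{j+1},\dots,f_m\rangle$ and $m_j=0$ otherwise. A differential operator of order $s$ means an operator $\sum_{j=0}^s f_j(d/dx)^j$ on polynomials with polynomial coefficients, $\deg f_j\le j$ and $f_s\ne0$. Let $D_\alpha=-x(d/dx)^2-(\alpha+1-x)\,d/dx$. Assume that $\langle\cdot,\cdot\rangle$ has a sequence of (left) orthogonal polynomials (that is, polynomials $p_n$, $n\ge 0$, with $\deg p_n=n$, $\langle p_n,p\rangle=0$ whenever $\deg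 p<n$, and $\langle p_n,p_n\rangle\ne0$), or that $\Omega(n)\ne0$ for all integers $n\ge0$. Then for every real polynomial $S$ there is a polynomial $P_S$ with $$P_S(x)-P_S(x-1)=S(x)\Omega(x),$$ and for every such $P_S$ (it is determined up to an additive constant) the operator $$D_S=P_S(D_\alpha)+\sum_{h=1}^m M_h(D_\alpha)\,\frac{d}{dx}\,\mathcal R_h(D_\alpha),\qquad M_h(x)=\sum_{j=1}^m(-1)^{h+j}S(x+j)\det\bigl(\mathcal R_l(x-(k-j))\bigr)_{1\le l,k\le m,\;l\ne h,\;k\ne j},$$ has every $q_n$, $n\ge0$, as an eigenfunction ($q_n\neq 0$ and $D_S(q_n)=P_S(n)q_n$); if $S\ne0$, then $D_S$ is a differential operator of order exactly $2(\deg S+\operatorname{awr}(M)+1)$. In particular, there are differential operators of positive order having all $q_n$ as eigenfunctions, and the minimal order of such operators is at most $2(\operatorname{awr}(M)+1)$. -/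

import Mathlib

open Polynomial MeasureTheory

noncomputable section

namespace LaguerreSobolev

/-! ### The bilinear form and left orthogonal polynomials -/

/-- The discrete Laguerre-Sobolev bilinear form
`⟨p, q⟩ = ∫_0^∞ p(x) q(x) x^(α-m) e^(-x) dx + ∑_{i,j<m} p^(i)(0) M_{i,j} q^(j)(0)`
(used only for integers `m ≤ α`, so that the integral converges for all polynomials). -/
def sobolevForm {m : ℕ} (α : ℕ) (M : Matrix (Fin m) (Fin m) ℝ) (p q : ℝ[X]) : ℝ :=
  (∫ x in Set.Ioi (0 : ℝ), p.eval x * q.eval x * (x ^ (α - m) * Real.exp (-x))) +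
    ∑ i : Fin m, ∑ j : Fin m,
      (derivative^[(i : ℕ)] p).eval 0 * M i j * (derivative^[(j : ℕ)] q).eval 0

/-- The form `B` has a sequence of (left) orthogonal polynomials: `deg q_n = n`,
`B(q_n, p) = 0` for all `p` of degree less than `n`, and `B(q_n, q_n) ≠ 0`. -/
def HasLeftOrthogonalPolynomials (B : ℝ[X] → ℝ[X] → ℝ) : Prop :=
  ∃ q : ℕ → ℝ[X], ∀ n : ℕ, (q n).degree = n ∧
    (∀ p : ℝ[X], p.degree < n → B (q n) p = 0) ∧ B (q n) (q n) ≠ 0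

/-! ### The polynomials `ℛ_l`, the Casorati determinant and the polynomials `q_n` -/

/-- The Pochhammer symbol `(X + a)_k = (X + a)(X + a + 1) ⋯ (X + a + k - 1)`
as a polynomial in `X`. -/
def poch (a : ℝ) (k : ℕ) : ℝ[X] := (ascPochhammer ℝ k).comp (X + C a)

/-- The polynomials `ℛ_{l+1}`, `l = 0, …, m-1`. For integers `α ≥ m` one has
`Γ(α-m+l+1) = (α-m+l)!`, `Γ(α+i+1) = (α+i)!`, and `Γ(α+1+x)/Γ(1+x)` is the polynomial
`(x+1)_α`. -/
def calR {m : ℕ} (α : ℕ) (M : Matrix (Fin m) (Fin m) ℝ) (l : Fin m) : ℝ[X] :=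
  C ((Nat.factorial (α - m + l) : ℝ) / Nat.factorial (m - 1 - l)) * poch 1 (m - 1 - l) +
    C (Nat.factorial l : ℝ) * poch 1 α *
      ∑ i : Fin m, C ((-1) ^ (i : ℕ) * M l i / (Nat.factorial (α + i) : ℝ)) * poch (1 - i) i

/-- The Casorati determinant `Ω(x) = det (ℛ_i(x - j))_{i,j=1}^m`, as a polynomial in `x`. -/
def casorati {m : ℕ} (α : ℕ) (M : Matrix (Fin m) (Fin m) ℝ) : ℝ[X] :=
  Matrix.det (Matrix.of fun i j : Fin m => (calR α M i).comp (X - C ((j : ℝ) + 1)))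

/-- The Laguerre polynomial `L_n^α(x) = ∑_{j=0}^n (-x)^j / j! * binom(n+α, n-j)`. -/
def laguerre (α n : ℕ) : ℝ[X] :=
  ∑ j ∈ Finset.range (n + 1),
    C ((-1) ^ j / (Nat.factorial j : ℝ) * (Nat.choose (n + α) (n - j) : ℝ)) * X ^ j

/-- The polynomial `q_n`: the `(m+1) × (m+1)` determinant with first row `L_{n-j}^α`,
`j = 0, …, m` (where `L_k^α = 0` for `k < 0`), and further rows `ℛ_i(n-j)`, `i = 1, …, m`. -/
def sobolevPoly {m : ℕ} (α : ℕ) (M : Matrix (Fin m) (Fin m) ℝ) (n : ℕ) : ℝ[X] :=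
  Matrix.det (Matrix.of (Fin.cons
    (fun j : Fin (m + 1) => if (j : ℕ) ≤ n then laguerre α (n - j) else 0)
    (fun (i : Fin m) (j : Fin (m + 1)) => C ((calR α M i).eval ((n : ℝ) - (j : ℝ)))) :
      Fin (m + 1) → Fin (m + 1) → ℝ[X]))

/-! ### Differential operators -/

/-- `D` is a differential operator `∑_{j=0}^s f_j (d/dx)^j` of order exactly `s`, with
polynomial coefficients satisfying `deg f_j ≤ j`, and `f_s ≠ 0`. -/
def IsDiffOpOfOrder (D : Module.End ℝ ℝ[X]) (s : ℕ) : Prop :=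
  ∃ f : ℕ → ℝ[X], (∀ j, (f j).natDegree ≤ j) ∧ f s ≠ 0 ∧
    ∀ p : ℝ[X], D p = ∑ j ∈ Finset.range (s + 1), f j * derivative^[j] p

/-- The Laguerre operator `D_α = -x (d/dx)^2 - (α + 1 - x) d/dx`. -/
def laguerreOp (α : ℕ) : Module.End ℝ ℝ[X] :=
  -(LinearMap.mulLeft ℝ X ∘ₗ derivative ∘ₗ derivative) -
    LinearMap.mulLeft ℝ (C ((α : ℝ) + 1) - X) ∘ₗ derivative

/-- The polynomials `M_h(x) = ∑_j (-1)^(h+j) S(x+j) det (ℛ_l(x-(k-j)))_{l ≠ h, k ≠ j}`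
(`h, j, l, k` from `1` to `m`): the signed minor is the `(j, h)` entry of the adjugate of the
matrix `(ℛ_l(x-(k-j)))_{l,k}`. -/
def auxPoly {m : ℕ} (α : ℕ) (M : Matrix (Fin m) (Fin m) ℝ) (S : ℝ[X]) (h : Fin m) : ℝ[X] :=
  ∑ j : Fin m, S.comp (X + C ((j : ℝ) + 1)) *
    (Matrix.of fun l k : Fin m =>
      (calR α M l).comp (X - C ((k : ℝ) - (j : ℝ)))).adjugate j h

/-- The operator `D_S = P(D_α) + ∑_{h=1}^m M_h(D_α) ∘ d/dx ∘ ℛ_h(D_α)`, where `P = P_S`. -/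
def sobolevOp {m : ℕ} (α : ℕ) (M : Matrix (Fin m) (Fin m) ℝ) (S P : ℝ[X]) :
    Module.End ℝ ℝ[X] :=
  aeval (laguerreOp α) P +
    ∑ h : Fin m, aeval (laguerreOp α) (auxPoly α M S h) ∘ₗ derivative ∘ₗ
      aeval (laguerreOp α) (calR α M h)

/-! ### The weighted rank -/

/-- Column `c` of `M` is not a linear combination of the columns to the right of it. -/
def IsPivotCol {m : ℕ} (M : Matrix (Fin m) (Fin m) ℝ) (c : Fin m) : Prop :=
  M.col c ∉ Submodule.span ℝ (M.col '' Set.Ioi c)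

/-- The matrix `M̃` consisting of the pivot columns of `M`. -/
def pivotMatrix {m : ℕ} (M : Matrix (Fin m) (Fin m) ℝ) :
    Matrix (Fin m) {c : Fin m // IsPivotCol M c} ℝ :=
  M.submatrix id Subtype.val

open Classical in
/-- The `α`-weighted rank `∑ n_j + ∑ m_j - m(m-1)/2`. With columns and rows numbered from `0`,
a pivot column `c` contributes `α + c` (this is `n_j` for `j = m - c`), and a row `r` of `M̃`
that is a linear combination of the rows below it contributes `m - 1 - r` (this is `m_j` for
`j = r + 1`; the last row never contributes). -/
def awr {m : ℕ} (α : ℕ) (M : Matrix (Fin m) (Fin m) ℝ) : ℤ :=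
  (∑ c : Fin m, if IsPivotCol M c then ((α : ℤ) + c) else 0) +
    (∑ r : Fin m,
      if (pivotMatrix M).row r ∈ Submodule.span ℝ ((pivotMatrix M).row '' Set.Ioi r)
      then ((m : ℤ) - 1 - r) else 0) -
    (m : ℤ) * (m - 1) / 2

end LaguerreSobolev

end

/-! Eigenvalue equation. In the basis $L_n^\alpha$ the operator $D_\alpha$ is diagonal with
eigenvalue $n$, and $(L_n^\alpha)'=-\sum_{k<n}L_k^\alpha$. Hence $D_S$ is triangular there, with
diagonal $P_S(n)$ and off-diagonal entries $-K(n,k)$, where $K(z,y)=\sum_h M_h(y)\mathcal R_h(z)$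
(`kernelOp_laguerre`). The coefficients $b_i$ of $q_n$ satisfy $\sum_i b_i\mathcal R_h(n-i)=0$. By
Cramer's rule, $K$ is a sum of Casorati determinants with one column replaced by $\mathcal R(z)$,
and such a determinant is $0$ or $\Omega$ when $z$ is one of the shifts already present. What
remains is a sum of values of $S\Omega$, which telescopes to a difference of values of $P_S$
(`sum_mul_kernelSum`, `kernelOp_eigen`).

Nonvanishing. The $x^n$ coefficient of $q_n$ is $\Omega(n)$ times that of $L_n^\alpha$. Since
$\mathcal R_l(n)=\langle x^{l-1},L_n^\alpha\rangle$, a zero of $\Omega$ at $n$ would produce a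
polynomial of degree below $n$ that the existence of left orthogonal polynomials forbids
(`eval_casorati_ne_zero`).

Order. Row vectors adapted to pivot columns and dependent rows give a basis of the span of the
$\mathcal R_l$ with pairwise distinct degrees (`exists_basis_calR`). A change of basis multiplies
both $\Omega$ and the sum in $D_S$ by a constant (`det_casoratiMatrix_mul`, `sum_minorSum_mul`). For
distinct degrees, shifts turned into differences show that $\Omega$ has degree
$\operatorname{awr}(M)$, with a Vandermonde determinant in its leading coefficient, and bound the
degree of each product $M_h\mathcal R_h$ by $\deg S+\operatorname{awr}(M)<\deg P_S$. So
$P_S(D_\alpha)$ alone determines the order, $2\deg P_S$. -/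

noncomputable section

namespace LaguerreSobolev

section IntegerDegree

/-! ### Degrees bounded by integers -/

/-- All coefficients of `p` above the integer `d` vanish; for `d < 0` this means `p = 0`. -/
def DegLE (p : ℝ[X]) (d : ℤ) : Prop := ∀ i : ℕ, d < i → p.coeff i = 0

/-- The coefficient of `p` at an integer exponent. -/
def zcoeff (p : ℝ[X]) (d : ℤ) : ℝ := if 0 ≤ d then p.coeff d.toNat else 0

@[simp] lemma zcoeff_natCast (p : ℝ[X]) (d : ℕ) : zcoeff p d = p.coeff d := by simp [zcoeff]

lemma zcoeff_of_neg (p : ℝ[X]) {d : ℤ} (h : d < 0) : zcoeff p d = 0 := by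
  simp [zcoeff, not_le.mpr h]

lemma degLE_natCast_iff {p : ℝ[X]} {d : ℕ} : DegLE p d ↔ p.natDegree ≤ d := by
  rw [natDegree_le_iff_coeff_eq_zero]
  simp [DegLE]

lemma DegLE.eq_zero {p : ℝ[X]} {d : ℤ} (h : DegLE p d) (hd : d < 0) : p = 0 := by
  ext i; simpa using h i (by omega)

lemma DegLE.mono {p : ℝ[X]} {d e : ℤ} (h : DegLE p d) (hde : d ≤ e) : DegLE p e :=
  fun i hi => h i (by omega)

lemma DegLE.zcoeff_eq_zero {p : ℝ[X]} {d e : ℤ} (h : DegLE p d) (hde : d < e) :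
    zcoeff p e = 0 := by
  unfold zcoeff
  split_ifs with he
  · exact h _ (by omega)
  · rfl

lemma degLE_zero (d : ℤ) : DegLE 0 d := fun i _ => by simp

lemma degLE_C (a : ℝ) : DegLE (C a) 0 := fun i hi => by
  rw [coeff_C, if_neg (by omega)]

lemma degLE_one : DegLE 1 0 := by simpa using degLE_C 1

lemma degLE_X : DegLE X 1 := fun i hi => by
  rw [coeff_X, if_neg (by omega)]

lemma degLE_natDegree (p : ℝ[X]) : DegLE p p.natDegree := degLE_natCast_iff.mpr le_rfl

lemma DegLE.add {p q : ℝ[X]} {d : ℤ} (hp : DegLE p d) (hq : DegLE q d) : DegLE (p + q) d :=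
  fun i hi => by simp [hp i hi, hq i hi]

lemma DegLE.sub {p q : ℝ[X]} {d : ℤ} (hp : DegLE p d) (hq : DegLE q d) : DegLE (p - q) d :=
  fun i hi => by simp [hp i hi, hq i hi]

lemma DegLE.sum {ι : Type*} {s : Finset ι} {f : ι → ℝ[X]} {d : ℤ}
    (h : ∀ i ∈ s, DegLE (f i) d) : DegLE (∑ i ∈ s, f i) d := fun k hk => by
  rw [finsetSum_coeff]
  exact Finset.sum_eq_zero fun i hi => h i hi k hk

lemma DegLE.mul {p q : ℝ[X]} {d e : ℤ} (hp : DegLE p d) (hq : DegLE q e) :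
    DegLE (p * q) (d + e) := fun i hi => by
  rw [coeff_mul]
  refine Finset.sum_eq_zero fun ab hab => ?_
  rw [Finset.HasAntidiagonal.mem_antidiagonal] at hab
  rcases lt_or_ge d ab.1 with h | h
  · rw [hp _ h, zero_mul]
  · rw [hq _ (by omega), mul_zero]

lemma DegLE.C_mul {p : ℝ[X]} {d : ℤ} (hp : DegLE p d) (a : ℝ) : DegLE (C a * p) d := by
  simpa using (degLE_C a).mul hp

lemma DegLE.smul {p : ℝ[X]} {d : ℤ} (hp : DegLE p d) (a : ℝ) : DegLE (a • p) d := by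
  rw [smul_eq_C_mul]; exact hp.C_mul a

lemma DegLE.derivative {p : ℝ[X]} {d : ℤ} (hp : DegLE p d) :
    DegLE (derivative p) (d - 1) := fun i hi => by
  rw [coeff_derivative, hp (i + 1) (by push_cast; omega), zero_mul]

lemma zcoeff_add (p q : ℝ[X]) (d : ℤ) : zcoeff (p + q) d = zcoeff p d + zcoeff q d := by
  unfold zcoeff; split_ifs <;> simp

lemma zcoeff_sum {ι : Type*} (s : Finset ι) (f : ι → ℝ[X]) (d : ℤ) :
    zcoeff (∑ i ∈ s, f i) d = ∑ i ∈ s, zcoeff (f i) d := by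
  unfold zcoeff; split_ifs <;> simp

lemma zcoeff_C_mul (a : ℝ) (p : ℝ[X]) (d : ℤ) : zcoeff (C a * p) d = a * zcoeff p d := by
  unfold zcoeff; split_ifs <;> simp

lemma zcoeff_mul {p q : ℝ[X]} {d e : ℤ} (hp : DegLE p d) (hq : DegLE q e) :
    zcoeff (p * q) (d + e) = zcoeff p d * zcoeff q e := by
  rcases lt_or_ge d 0 with hd | hd
  · rw [hp.eq_zero hd]; simp [zcoeff]
  rcases lt_or_ge e 0 with he | he
  · rw [hq.eq_zero he]; simp [zcoeff]
  lift d to ℕ using hd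
  lift e to ℕ using he
  rw [← Nat.cast_add, zcoeff_natCast, zcoeff_natCast, zcoeff_natCast]
  exact coeff_mul_add_eq_of_natDegree_le (degLE_natCast_iff.mp hp) (degLE_natCast_iff.mp hq)

lemma degLE_prod {ι : Type*} (s : Finset ι) {f : ι → ℝ[X]} {d : ι → ℤ}
    (h : ∀ i ∈ s, DegLE (f i) (d i)) :
    DegLE (∏ i ∈ s, f i) (∑ i ∈ s, d i) ∧
      zcoeff (∏ i ∈ s, f i) (∑ i ∈ s, d i) = ∏ i ∈ s, zcoeff (f i) (d i) := by
  classical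
  induction s using Finset.induction_on with
  | empty => exact ⟨by simpa using degLE_one, by simp [zcoeff]⟩
  | insert a s ha ih =>
    have h1 := h a (by simp)
    obtain ⟨h2, h3⟩ := ih fun i hi => h i (by simp [hi])
    rw [Finset.prod_insert ha, Finset.sum_insert ha, Finset.prod_insert ha]
    exact ⟨h1.mul h2, by rw [zcoeff_mul h1 h2, h3]⟩

/-- Every permutation product has the same total degree bound, so the top coefficients again
assemble into a determinant. -/
lemma degLE_det {n : Type*} [Fintype n] [DecidableEq n] {A : Matrix n n ℝ[X]} {a b : n → ℤ}
    (h : ∀ i j, DegLE (A i j) (a i - b j)) :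
    DegLE A.det (∑ i, a i - ∑ j, b j) ∧
      zcoeff A.det (∑ i, a i - ∑ j, b j) =
        Matrix.det (Matrix.of fun i j => zcoeff (A i j) (a i - b j)) := by
  have key : ∀ σ : Equiv.Perm n, DegLE (∏ i, A (σ i) i) (∑ i, a i - ∑ j, b j) ∧
      zcoeff (∏ i, A (σ i) i) (∑ i, a i - ∑ j, b j) = ∏ i, zcoeff (A (σ i) i) (a (σ i) - b i) := by
    intro σ
    have := degLE_prod Finset.univ (f := fun i => A (σ i) i) (d := fun i => a (σ i) - b i)
      fun i _ => h _ _
    rwa [Finset.sum_sub_distrib, Equiv.sum_comp σ a] at this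
  have sgn : ∀ (σ : Equiv.Perm n) (p : ℝ[X]),
      ((Equiv.Perm.sign σ : ℤ) : ℝ[X]) * p = C ((Equiv.Perm.sign σ : ℤ) : ℝ) * p := by
    intro σ p; simp
  rw [Matrix.det_apply', Matrix.det_apply']
  simp only [sgn, Matrix.of_apply]
  refine ⟨DegLE.sum fun σ _ => (key σ).1.C_mul _, ?_⟩
  rw [zcoeff_sum]
  exact Finset.sum_congr rfl fun σ _ => by rw [zcoeff_C_mul, (key σ).2]

/-- The entry is the determinant after row `l` is replaced by the unit vector at `k`; that row obeys
the same kind of bound with `a l` replaced by `b k`. -/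
lemma degLE_adjugate {n : Type*} [Fintype n] [DecidableEq n] {A : Matrix n n ℝ[X]} {a b : n → ℤ}
    (h : ∀ i j, DegLE (A i j) (a i - b j)) (k l : n) :
    DegLE (A.adjugate k l) (∑ i, a i - ∑ j, b j - a l + b k) := by
  have h1 : ∀ i j, DegLE (A.updateRow l (Pi.single k 1) i j)
      (Function.update a l (b k) i - b j) := by
    intro i j
    by_cases hi : i = l
    · subst hi
      simp only [Matrix.updateRow_self, Function.update_self]
      by_cases hj : j = k
      · subst hj; simpa using degLE_one
      · simpa [hj] using degLE_zero _
    · simpa [hi] using h i j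
  have h2 := (degLE_det h1).1
  rw [← Matrix.adjugate_apply, Finset.sum_update_of_mem (Finset.mem_univ l)] at h2
  refine h2.mono ?_
  rw [← Finset.add_sum_erase _ a (Finset.mem_univ l), Finset.sdiff_singleton_eq_erase]
  omega

/-! ### Shifts and differences -/

lemma coeff_taylor_eq_sum (c : ℝ) (p : ℝ[X]) (k : ℕ) {N : ℕ} (hN : p.natDegree < N) :
    (taylor c p).coeff k =
      ∑ n ∈ Finset.range N, p.coeff n * (c ^ (n - k) * (n.choose k : ℝ)) := by
  conv_lhs => rw [p.as_sum_range_C_mul_X_pow' hN]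
  simp [taylor_apply, coeff_X_add_C_pow]

lemma DegLE.sub_taylor {p : ℝ[X]} {d : ℤ} (hp : DegLE p d) (c : ℝ) :
    DegLE (p - taylor c p) (d - 1) ∧
      zcoeff (p - taylor c p) (d - 1) = -c * d * zcoeff p d := by
  rcases lt_or_ge d 0 with hd | hd
  · rw [hp.eq_zero hd]; simp [degLE_zero, zcoeff]
  lift d to ℕ using hd
  have hN : p.natDegree < d + 1 := Nat.lt_succ_of_le (degLE_natCast_iff.mp hp)
  constructor
  · intro i hi
    rw [coeff_sub, coeff_taylor_eq_sum c p i hN, Finset.sum_eq_single i]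
    · simp
    · intro n hn hni
      rw [Nat.choose_eq_zero_of_lt]
      · simp
      · have := Finset.mem_range.mp hn; omega
    · intro hi'
      rw [hp i (by simp at hi'; omega), zero_mul]
  · rcases d with _ | d
    -- In degree zero the exponent is `-1`, where `zcoeff` is `0` by convention; the factor `d` on
    -- the right vanishes too.
    · simp [zcoeff]
    · have : ((d + 1 : ℕ) : ℤ) - 1 = (d : ℕ) := by push_cast; ring
      rw [this, zcoeff_natCast, zcoeff_natCast, coeff_sub, coeff_taylor_eq_sum c p d hN,
        Finset.sum_range_succ, Finset.sum_range_succ, Finset.sum_eq_zero]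
      · simp; ring
      · intro n hn
        rw [Nat.choose_eq_zero_of_lt (Finset.mem_range.mp hn)]; simp

/-- The difference operator `p ↦ p(x) - p(x + c)`. -/
def differenceOp (c : ℝ) : Module.End ℝ ℝ[X] := 1 - taylor c

lemma differenceOp_apply (c : ℝ) (p : ℝ[X]) : differenceOp c p = p - taylor c p := rfl

lemma DegLE.differenceOp_pow {p : ℝ[X]} {d : ℤ} (hp : DegLE p d) (c : ℝ) (k : ℕ) :
    DegLE ((differenceOp c ^ k) p) (d - k) ∧
      zcoeff ((differenceOp c ^ k) p) (d - k) =
        (-c) ^ k * (descPochhammer ℝ k).eval (d : ℝ) * zcoeff p d := by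
  induction k with
  | zero => simpa using hp
  | succ k ih =>
    have h := ih.1.sub_taylor c
    rw [pow_succ', Module.End.mul_apply, differenceOp_apply]
    have e : d - ((k + 1 : ℕ) : ℤ) = d - k - 1 := by push_cast; ring
    rw [e]
    refine ⟨h.1, ?_⟩
    rw [h.2, ih.2, descPochhammer_succ_right]
    simp
    ring

lemma taylor_pow (c : ℝ) (k : ℕ) (p : ℝ[X]) :
    ((taylor c : Module.End ℝ ℝ[X]) ^ k) p = taylor (k * c) p := by
  induction k with
  | zero => simp
  | succ k ih =>
    rw [pow_succ', Module.End.mul_apply, ih, taylor_taylor]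
    congr 2; push_cast; ring

/-- Binomial theorem for `1 - taylor c`. The vanishing terms beyond `k` are kept so that the sum can
be read as a product with a square binomial matrix. -/
lemma differenceOp_pow_eq_sum (c : ℝ) (k N : ℕ) (hk : k < N) (p : ℝ[X]) :
    (differenceOp c ^ k) p =
      ∑ j : Fin N, ((-1) ^ (j : ℕ) * (k.choose j : ℝ)) • taylor (j * c) p := by
  have h : differenceOp c = (-1 : ℝ) • (taylor c : Module.End ℝ ℝ[X]) + 1 := by
    refine LinearMap.ext fun p => ?_
    simp [differenceOp, sub_eq_neg_add]
  rw [h, (Commute.one_right _).add_pow, LinearMap.sum_apply,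
    Fin.sum_univ_eq_sum_range (fun j => ((-1 : ℝ) ^ j * (k.choose j : ℝ)) • taylor (j * c) p) N]
  refine Finset.sum_subset_zero_on_sdiff (Finset.range_subset_range.mpr hk) ?_ ?_
  · intro j hj
    simp only [Finset.mem_sdiff, Finset.mem_range] at hj
    rw [Nat.choose_eq_zero_of_lt (by omega)]; simp
  · intro j _
    rw [_root_.smul_pow, ← taylor_pow, one_pow, mul_one, ← nsmul_eq_mul', mul_comm ((-1 : ℝ) ^ j),
      mul_smul, Nat.cast_smul_eq_nsmul]
    rfl

end IntegerDegree

section CasoratiDeterminant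

/-! ### Casorati determinants of general families of polynomials -/

variable {m : ℕ}

/-- The Casorati matrix `(R_l(x - k - 1))_{l,k}`, `0 ≤ l, k < m`. -/
def casoratiMatrix (R : Fin m → ℝ[X]) : Matrix (Fin m) (Fin m) ℝ[X] :=
  Matrix.of fun l k => taylor (-((k : ℝ) + 1)) (R l)

/-- The polynomials `M_h` for a general family `R`. -/
def minorSum (R : Fin m → ℝ[X]) (S : ℝ[X]) (h : Fin m) : ℝ[X] :=
  ∑ j : Fin m, taylor ((j : ℝ) + 1) (S * (casoratiMatrix R).adjugate j h)

lemma casorati_eq (α : ℕ) (M : Matrix (Fin m) (Fin m) ℝ) :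
    casorati α M = (casoratiMatrix (calR α M)).det := by
  unfold casorati casoratiMatrix
  congr; ext1 i; ext1 j
  rw [taylor_apply, map_neg, sub_eq_add_neg]

lemma map_taylor_casoratiMatrix (R : Fin m → ℝ[X]) (c : ℝ) :
    (casoratiMatrix R).map (taylor c) =
      Matrix.of fun l k : Fin m => taylor (c - ((k : ℝ) + 1)) (R l) := by
  ext1 l k
  simp only [casoratiMatrix, Matrix.map_apply, Matrix.of_apply, taylor_taylor]
  congr 2

lemma taylor_adjugate_casoratiMatrix (R : Fin m → ℝ[X]) (c : ℝ) (j h : Fin m) :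
    taylor c ((casoratiMatrix R).adjugate j h) =
      (Matrix.of fun l k : Fin m => taylor (c - ((k : ℝ) + 1)) (R l)).adjugate j h := by
  rw [← map_taylor_casoratiMatrix]
  have := (taylorAlgHom c).map_adjugate (casoratiMatrix R)
  exact congrFun (congrFun this j) h

lemma auxPoly_eq (α : ℕ) (M : Matrix (Fin m) (Fin m) ℝ) (S : ℝ[X]) (h : Fin m) :
    auxPoly α M S h = minorSum (calR α M) S h := by
  unfold auxPoly minorSum
  refine Finset.sum_congr rfl fun j _ => ?_
  rw [taylor_mul, taylor_adjugate_casoratiMatrix, taylor_apply]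
  congr; ext1 l; ext1 k
  rw [taylor_apply, sub_eq_add_neg X, ← map_neg]
  congr 3; ring

/-- The signed binomial matrix turning shifts into differences. -/
def binomialMatrix (m : ℕ) : Matrix (Fin m) (Fin m) ℝ :=
  Matrix.of fun j k => (-1) ^ (j : ℕ) * ((k : ℕ).choose j : ℝ)

lemma det_binomialMatrix_ne_zero : (binomialMatrix m).det ≠ 0 := by
  rw [Matrix.det_of_isUpperTriangular]
  · rw [Finset.prod_ne_zero_iff]
    intro i _
    simp [binomialMatrix]
  · intro i j hij
    simp only [binomialMatrix, Matrix.of_apply]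
    rw [Nat.choose_eq_zero_of_lt (by simpa using hij)]; simp

/-- Column operations replace shifts by backward differences. Column `k` then loses `k` degrees,
which is the shape `a i - b j` required by `degLE_det`. -/
lemma casoratiMatrix_mul_binomialMatrix (R : Fin m → ℝ[X]) (l k : Fin m) :
    (casoratiMatrix R * (binomialMatrix m).map C) l k =
      (differenceOp (-1) ^ (k : ℕ)) (taylor (-1) (R l)) := by
  rw [differenceOp_pow_eq_sum _ _ m k.2, Matrix.mul_apply]
  refine Finset.sum_congr rfl fun j _ => ?_
  simp only [casoratiMatrix, binomialMatrix, Matrix.map_apply, Matrix.of_apply, taylor_taylor,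
    smul_eq_C_mul]
  rw [mul_comm]
  congr 3; ring

lemma DegLE.taylor {p : ℝ[X]} {d : ℤ} (hp : DegLE p d) (c : ℝ) :
    DegLE (taylor c p) d ∧ zcoeff (taylor c p) d = zcoeff p d := by
  have h := (hp.sub_taylor c).1
  have e : p = (p - Polynomial.taylor c p) + Polynomial.taylor c p := by ring
  constructor
  · have := hp.sub (h.mono (by omega : d - 1 ≤ d))
    simpa using this
  · conv_rhs => rw [e]
    rw [zcoeff_add, h.zcoeff_eq_zero (by omega), zero_add]

lemma degLE_casoratiMatrix_mul (R : Fin m → ℝ[X]) {a : Fin m → ℤ} (h : ∀ l, DegLE (R l) (a l))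
    (l k : Fin m) :
    DegLE ((casoratiMatrix R * (binomialMatrix m).map C) l k) (a l - (k : ℕ)) ∧
      zcoeff ((casoratiMatrix R * (binomialMatrix m).map C) l k) (a l - (k : ℕ)) =
        (descPochhammer ℝ k).eval (a l : ℝ) * zcoeff (R l) (a l) := by
  rw [casoratiMatrix_mul_binomialMatrix]
  have h1 := (h l).taylor (-1)
  have h2 := h1.1.differenceOp_pow (-1) k
  refine ⟨h2.1, ?_⟩
  rw [h2.2, h1.2]; simp

/-- The degree of a Casorati determinant with rows of different degrees. -/
lemma degLE_det_casoratiMatrix (R : Fin m → ℝ[X]) {a : Fin m → ℤ} (ha : Function.Injective a)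
    (h : ∀ l, DegLE (R l) (a l)) (h0 : ∀ l, zcoeff (R l) (a l) ≠ 0) :
    DegLE (casoratiMatrix R).det (∑ l, a l - ∑ k : Fin m, ((k : ℕ) : ℤ)) ∧
      zcoeff (casoratiMatrix R).det (∑ l, a l - ∑ k : Fin m, ((k : ℕ) : ℤ)) ≠ 0 := by
  set e := (binomialMatrix m).det with he
  have he0 : e ≠ 0 := det_binomialMatrix_ne_zero
  have key := degLE_det (A := casoratiMatrix R * (binomialMatrix m).map C) (a := a)
    (b := fun k : Fin m => ((k : ℕ) : ℤ)) fun l k => (degLE_casoratiMatrix_mul R h l k).1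
  have hdet : (casoratiMatrix R * (binomialMatrix m).map C).det =
      C e * (casoratiMatrix R).det := by
    rw [Matrix.det_mul, mul_comm, he, RingHom.map_det]; rfl
  have hdet' : (casoratiMatrix R).det =
      C e⁻¹ * (casoratiMatrix R * (binomialMatrix m).map C).det := by
    rw [hdet, ← mul_assoc, ← C_mul, inv_mul_cancel₀ he0, C_1, one_mul]
  rw [hdet']
  refine ⟨key.1.C_mul _, ?_⟩
  rw [zcoeff_C_mul, key.2]
  refine mul_ne_zero (inv_ne_zero he0) ?_
  simp only [(degLE_casoratiMatrix_mul R h _ _).2]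
  -- The leading coefficients involve falling factorials of the degrees, and these are monic of
  -- degree `j`: up to row factors this is the Vandermonde determinant of the degrees.
  have hv : (Matrix.of fun i j : Fin m =>
      (descPochhammer ℝ j).eval (a i : ℝ) * zcoeff (R i) (a i)).det =
      (∏ i, zcoeff (R i) (a i)) * (Matrix.vandermonde fun i => (a i : ℝ)).det := by
    rw [Matrix.det_eval_matrixOfPolynomials_eq_det_vandermonde (fun i => (a i : ℝ))
      (fun j => descPochhammer ℝ j) (fun j => descPochhammer_natDegree ℝ j)
      (fun j => monic_descPochhammer ℝ j), ← Matrix.det_mul_column]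
    congr; ext1 i; ext1 j; exact mul_comm _ _
  rw [hv]
  refine mul_ne_zero (Finset.prod_ne_zero_iff.mpr fun i _ => h0 i) ?_
  rw [Matrix.det_vandermonde_ne_zero_iff]
  intro i j hij
  exact ha (by simpa using hij)

/-- Bounding the shifted cofactors one by one ignores cancellation. Rewritten through the difference
matrix `B`, the sum over shifts becomes a sum of `k`-th forward differences of `S` times an adjugate
entry in row `k`; the excess degree `k` of that entry is exactly what the difference removes. -/
lemma degLE_minorSum (R : Fin m → ℝ[X]) {S : ℝ[X]} {a : Fin m → ℤ} {s : ℤ}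
    (h : ∀ l, DegLE (R l) (a l)) (hS : DegLE S s) (i : Fin m) :
    DegLE (minorSum R S i) (s + (∑ l, a l - ∑ k : Fin m, ((k : ℕ) : ℤ)) - a i) := by
  set e := (binomialMatrix m).det with he
  have he0 : e ≠ 0 := det_binomialMatrix_ne_zero
  set B := casoratiMatrix R * (binomialMatrix m).map C with hB
  -- Taking adjugates reverses the product, and the binomial matrix times its own adjugate is the
  -- scalar `e`.
  have hadj : C e • (casoratiMatrix R).adjugate = (binomialMatrix m).map C * B.adjugate := by
    rw [hB, Matrix.adjugate_mul_distrib, ← mul_assoc, Matrix.mul_adjugate, smul_mul_assoc, one_mul,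
      he, RingHom.map_det]
    rfl
  have hsum : C e * minorSum R S i =
      ∑ k : Fin m, (differenceOp 1 ^ (k : ℕ)) (taylor 1 (S * B.adjugate k i)) := by
    have h1 : ∀ j, C e * (casoratiMatrix R).adjugate j i =
        ∑ k, C (binomialMatrix m j k) * B.adjugate k i := fun j => by
      have := congrFun (congrFun hadj j) i
      simpa [Matrix.mul_apply] using this
    simp only [differenceOp_pow_eq_sum _ _ m (Fin.is_lt _)]
    rw [Finset.sum_comm, minorSum, Finset.mul_sum]
    refine Finset.sum_congr rfl fun j _ => ?_
    have h2 : C e * taylor ((j : ℝ) + 1) (S * (casoratiMatrix R).adjugate j i) =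
        taylor ((j : ℝ) + 1) (S * (C e * (casoratiMatrix R).adjugate j i)) := by
      rw [← smul_eq_C_mul, ← map_smul, smul_eq_C_mul]; congr 1; ring
    rw [h2, h1, Finset.mul_sum, map_sum]
    refine Finset.sum_congr rfl fun k _ => ?_
    rw [mul_left_comm, ← smul_eq_C_mul, map_smul, taylor_taylor, mul_one]
    rfl
  have hdeg : DegLE (C e * minorSum R S i)
      (s + (∑ l, a l - ∑ k : Fin m, ((k : ℕ) : ℤ)) - a i) := by
    rw [hsum]
    refine DegLE.sum fun k _ => ?_
    have h1 := degLE_adjugate (A := B) (a := a) (b := fun k : Fin m => ((k : ℕ) : ℤ))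
      (fun l k => (degLE_casoratiMatrix_mul R h l k).1) k i
    have h2 := (((hS.mul h1).taylor 1).1.differenceOp_pow 1 k).1
    refine h2.mono ?_
    linarith
  have := hdeg.C_mul e⁻¹
  rwa [← mul_assoc, ← C_mul, inv_mul_cancel₀ he0, C_1, one_mul] at this

/-! ### Change of basis -/

lemma casoratiMatrix_mul (A : Matrix (Fin m) (Fin m) ℝ) (R : Fin m → ℝ[X]) :
    casoratiMatrix (fun h => ∑ l, A h l • R l) = A.map C * casoratiMatrix R := by
  ext1 h k
  simp [casoratiMatrix, Matrix.mul_apply, smul_eq_C_mul]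

lemma det_casoratiMatrix_mul (A : Matrix (Fin m) (Fin m) ℝ) (R : Fin m → ℝ[X]) :
    (casoratiMatrix (fun h => ∑ l, A h l • R l)).det = C A.det * (casoratiMatrix R).det := by
  rw [casoratiMatrix_mul, Matrix.det_mul, RingHom.map_det]; rfl

lemma minorSum_mul (A : Matrix (Fin m) (Fin m) ℝ) (R : Fin m → ℝ[X]) (S : ℝ[X]) (h : Fin m) :
    minorSum (fun h => ∑ l, A h l • R l) S h = ∑ i, A.adjugate i h • minorSum R S i := by
  have hadj : (A.map C).adjugate = A.adjugate.map (C : ℝ →+* ℝ[X]) :=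
    ((C : ℝ →+* ℝ[X]).map_adjugate A).symm
  have hj : ∀ j, (casoratiMatrix (fun h => ∑ l, A h l • R l)).adjugate j h =
      ∑ i, A.adjugate i h • (casoratiMatrix R).adjugate j i := fun j => by
    rw [casoratiMatrix_mul, Matrix.adjugate_mul_distrib, hadj, Matrix.mul_apply]
    refine Finset.sum_congr rfl fun i _ => ?_
    rw [Matrix.map_apply, smul_eq_C_mul, mul_comm]
  unfold minorSum
  simp only [hj, Finset.smul_sum]
  rw [Finset.sum_comm]
  refine Finset.sum_congr rfl fun j _ => ?_
  rw [Finset.mul_sum, map_sum]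
  refine Finset.sum_congr rfl fun i _ => ?_
  rw [mul_smul_comm, LinearMap.map_smul]

/-- The minors transform by the adjugate of `A` and the family by `A`, so the mixed terms collapse
through `adjugate A * A = det A`. The operator can thus be studied in any convenient basis. -/
lemma sum_minorSum_mul (A : Matrix (Fin m) (Fin m) ℝ) (R : Fin m → ℝ[X]) (S : ℝ[X])
    (L D : Module.End ℝ ℝ[X]) :
    ∑ h, aeval L (minorSum (fun h => ∑ l, A h l • R l) S h) * D * aeval L (∑ l, A h l • R l) =
      A.det • ∑ h, aeval L (minorSum R S h) * D * aeval L (R h) := by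
  have h1 : ∀ i l, ∑ h, A.adjugate i h * A h l = if i = l then A.det else 0 := fun i l => by
    have := congrFun (congrFun A.adjugate_mul i) l
    simpa [Matrix.mul_apply, Matrix.one_apply] using this
  have h2 : ∀ h, aeval L (minorSum (fun h => ∑ l, A h l • R l) S h) * D *
      aeval L (∑ l, A h l • R l) =
        ∑ i, ∑ l, (A.adjugate i h * A h l) • (aeval L (minorSum R S i) * D * aeval L (R l)) := by
    intro h
    rw [minorSum_mul, map_sum, map_sum, Finset.sum_mul, Finset.sum_mul]
    refine Finset.sum_congr rfl fun i _ => ?_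
    rw [Finset.mul_sum]
    refine Finset.sum_congr rfl fun l _ => ?_
    rw [map_smul, map_smul, smul_mul_assoc, smul_mul_assoc, mul_smul_comm, smul_smul]
  simp only [h2]
  rw [Finset.sum_comm, Finset.smul_sum]
  refine Finset.sum_congr rfl fun i _ => ?_
  rw [Finset.sum_comm]
  simp only [← Finset.sum_smul, h1, ite_smul, zero_smul, Finset.sum_ite_eq, Finset.mem_univ,
    if_true]

end CasoratiDeterminant

section OrderOfOperators

/-! ### Orders and leading coefficients of differential operators -/

/-- `D = ∑_{j ≤ s} f_j (d/dx)^j` with `deg f_j ≤ j - e` and `f_s = g` (possibly zero). -/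
def HasLeadingTerm (D : Module.End ℝ ℝ[X]) (s : ℕ) (e : ℤ) (g : ℝ[X]) : Prop :=
  ∃ f : ℕ → ℝ[X], (∀ j : ℕ, DegLE (f j) (j - e)) ∧ (∀ j, s < j → f j = 0) ∧ f s = g ∧
    ∀ (p : ℝ[X]) (N : ℕ), s < N → D p = ∑ j ∈ Finset.range N, f j * derivative^[j] p

namespace HasLeadingTerm

variable {D D' : Module.End ℝ ℝ[X]} {s t : ℕ} {e e' : ℤ} {g g' : ℝ[X]}

lemma isDiffOpOfOrder (h : HasLeadingTerm D s 0 g) (hg : g ≠ 0) : IsDiffOpOfOrder D s := by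
  obtain ⟨f, h1, -, h3, h4⟩ := h
  exact ⟨f, fun j => degLE_natCast_iff.mp (by simpa using h1 j), h3 ▸ hg,
    fun p => h4 p _ (Nat.lt_succ_self s)⟩

lemma one : HasLeadingTerm 1 0 0 1 := by
  refine ⟨fun j => if j = 0 then 1 else 0, fun j => ?_, fun j hj => if_neg hj.ne', rfl, ?_⟩
  · dsimp only
    split_ifs with hj
    · exact degLE_one.mono (by omega)
    · exact degLE_zero _
  · intro p N hN
    rw [Finset.sum_eq_single_of_mem 0 (Finset.mem_range.mpr hN)]
    · simp
    · intro j _ hj; simp [hj]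

lemma zero (s : ℕ) (e : ℤ) : HasLeadingTerm 0 s e 0 :=
  ⟨fun _ => 0, fun _ => degLE_zero _, fun _ _ => rfl, rfl, fun p N _ => by simp⟩

lemma mono_order (h : HasLeadingTerm D s e g) (hst : s < t) : HasLeadingTerm D t e 0 := by
  obtain ⟨f, h1, h2, -, h4⟩ := h
  exact ⟨f, h1, fun j hj => h2 j (hst.trans hj), h2 t hst, fun p N hN => h4 p N (hst.trans hN)⟩

lemma mono_shift (h : HasLeadingTerm D s e g) (he : e' ≤ e) : HasLeadingTerm D s e' g := by
  obtain ⟨f, h1, h2, h3, h4⟩ := h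
  exact ⟨f, fun j => (h1 j).mono (by omega), h2, h3, h4⟩

lemma add (h : HasLeadingTerm D s e g) (h' : HasLeadingTerm D' s e g') :
    HasLeadingTerm (D + D') s e (g + g') := by
  obtain ⟨f, h1, h2, h3, h4⟩ := h
  obtain ⟨f', h1', h2', h3', h4'⟩ := h'
  refine ⟨fun j => f j + f' j, fun j => (h1 j).add (h1' j), fun j hj => ?_, by simp only [h3, h3'],
    fun p N hN => ?_⟩
  · simp only [h2 j hj, h2' j hj, add_zero]
  · simp only [LinearMap.add_apply, h4 p N hN, h4' p N hN, add_mul, Finset.sum_add_distrib]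

lemma sum {ι : Type*} {u : Finset ι} {F : ι → Module.End ℝ ℝ[X]}
    (h : ∀ i ∈ u, HasLeadingTerm (F i) s e 0) : HasLeadingTerm (∑ i ∈ u, F i) s e 0 := by
  classical
  induction u using Finset.induction_on with
  | empty => simpa using zero s e
  | insert a u ha ih =>
    rw [Finset.sum_insert ha]
    simpa using (h a (by simp)).add (ih fun i hi => h i (by simp [hi]))

lemma smul (h : HasLeadingTerm D s e g) (a : ℝ) : HasLeadingTerm (a • D) s e (C a * g) := by
  obtain ⟨f, h1, h2, h3, h4⟩ := h
  refine ⟨fun j => C a * f j, fun j => (h1 j).C_mul a, fun j hj => by simp only [h2 j hj, mul_zero],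
    by simp only [h3], fun p N hN => ?_⟩
  rw [LinearMap.smul_apply, h4 p N hN, smul_eq_C_mul, Finset.mul_sum]
  exact Finset.sum_congr rfl fun j _ => by ring

lemma mulLeft_X (h : HasLeadingTerm D s e g) :
    HasLeadingTerm (LinearMap.mulLeft ℝ X * D) s (e - 1) (X * g) := by
  obtain ⟨f, h1, h2, h3, h4⟩ := h
  refine ⟨fun j => X * f j, fun j => (degLE_X.mul (h1 j)).mono (by omega),
    fun j hj => by simp only [h2 j hj, mul_zero], by simp only [h3], fun p N hN => ?_⟩
  rw [Module.End.mul_apply, LinearMap.mulLeft_apply, h4 p N hN, Finset.mul_sum]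
  exact Finset.sum_congr rfl fun j _ => by ring

lemma derivative_mul (h : HasLeadingTerm D s e g) :
    HasLeadingTerm (derivative * D) (s + 1) (e + 1) g := by
  obtain ⟨f, h1, h2, h3, h4⟩ := h
  refine ⟨fun j => derivative (f j) + (if j = 0 then 0 else f (j - 1)), fun j => ?_, fun j hj => ?_,
    ?_, fun p N hN => ?_⟩
  · refine ((h1 j).derivative.mono (by omega)).add ?_
    split_ifs with hj
    · exact degLE_zero _
    · exact (h1 (j - 1)).mono (by omega)
  · simp only [h2 j (by omega), h2 (j - 1) (by omega), derivative_zero, ite_self, add_zero]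
  · simp [h2 (s + 1) (Nat.lt_succ_self s), h3]
  · obtain ⟨N, rfl⟩ : ∃ n, N = n + 1 := ⟨N - 1, by omega⟩
    have hN' : s < N := by omega
    rw [Module.End.mul_apply, h4 p N hN', derivative_sum]
    simp only [add_mul, Polynomial.derivative_mul]
    rw [Finset.sum_add_distrib, Finset.sum_add_distrib]
    congr 1
    · rw [Finset.sum_range_succ, h2 N hN']; simp
    · rw [Finset.sum_range_succ']
      simp [Function.iterate_succ_apply']

lemma laguerreOp_mul (h : HasLeadingTerm D s 0 g) (α : ℕ) :
    HasLeadingTerm (laguerreOp α * D) (s + 2) 0 (-X * g) := by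
  have e1 : laguerreOp α * D =
      (-1 : ℝ) • (LinearMap.mulLeft ℝ X * (derivative * (derivative * D))) +
        ((-((α : ℝ) + 1)) • (derivative * D) + LinearMap.mulLeft ℝ X * (derivative * D)) := by
    refine LinearMap.ext fun p => ?_
    simp only [laguerreOp, Module.End.mul_apply, LinearMap.sub_apply, LinearMap.neg_apply,
      LinearMap.comp_apply, LinearMap.add_apply, LinearMap.smul_apply, LinearMap.mulLeft_apply,
      smul_eq_C_mul, map_neg, C_1]
    ring
  rw [e1]
  -- The parameter `e` does the bookkeeping here: each derivative gains one in the degree bound and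
  -- each factor `X` costs one, so every term keeps the bound `deg f_j ≤ j`.
  have h1 := h.derivative_mul
  have h2 := (h1.derivative_mul.mulLeft_X.smul (-1)).mono_shift (e' := 0) (by norm_num)
  have h3 := ((h1.smul (-((α : ℝ) + 1))).mono_order (t := s + 2) (by omega)).mono_shift
    (e' := 0) (by norm_num)
  have h4 := (h1.mulLeft_X.mono_order (t := s + 2) (by omega)).mono_shift (e' := 0) (by norm_num)
  simpa using h2.add (h3.add h4)

/-- Horner's scheme `p = X * divX p + p(0)`. Only a degree bound `n` is assumed, since the top
coefficient may vanish along the way. -/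
lemma aeval_laguerreOp_mul (h : HasLeadingTerm D s 0 g) (α : ℕ) {n : ℕ} :
    ∀ {p : ℝ[X]}, p.natDegree ≤ n →
    HasLeadingTerm (aeval (laguerreOp α) p * D) (s + 2 * n) 0 (C (p.coeff n) * (-X) ^ n * g) := by
  induction n with
  | zero =>
    intro p hp
    rw [eq_C_of_natDegree_le_zero hp, aeval_C, Algebra.algebraMap_eq_smul_one, smul_mul_assoc,
      one_mul]
    simpa using h.smul (p.coeff 0)
  | succ n ih =>
    intro p hp
    have h1 := (ih (p := p.divX) (by rw [natDegree_divX_eq_natDegree_tsub_one]; omega))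
    have h2 := h1.laguerreOp_mul α
    have h3 := (h.smul (p.coeff 0)).mono_order (t := s + 2 * n + 2) (by omega)
    have e1 : aeval (laguerreOp α) p * D =
        laguerreOp α * (aeval (laguerreOp α) p.divX * D) + p.coeff 0 • D := by
      conv_lhs => rw [← X_mul_divX_add p]
      rw [map_add, map_mul, aeval_X, aeval_C, add_mul, mul_assoc, Algebra.algebraMap_eq_smul_one,
        smul_mul_assoc, one_mul]
    rw [e1]
    have h4 := h2.add h3
    have e2 : -X * (C (p.divX.coeff n) * (-X) ^ n * g) =
        C (p.coeff (n + 1)) * (-X) ^ (n + 1) * g := by rw [coeff_divX]; ring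
    rw [add_zero] at h4
    rw [e2] at h4
    exact h4

end HasLeadingTerm

/-- The order of `P(D_α) + ∑_h M_h(D_α) ∘ d/dx ∘ R_h(D_α)` when the degrees of the products
`M_h R_h` are less than the degree of `P`. -/
lemma isDiffOpOfOrder_aeval_add_sum (α : ℕ) {P : ℝ[X]} (hP : P ≠ 0) {ι : Type*} (u : Finset ι)
    (F R : ι → ℝ[X]) (h : ∀ i ∈ u, F i = 0 ∨ (F i).natDegree + (R i).natDegree < P.natDegree) :
    IsDiffOpOfOrder (aeval (laguerreOp α) P +
      ∑ i ∈ u, aeval (laguerreOp α) (F i) * derivative * aeval (laguerreOp α) (R i))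
      (2 * P.natDegree) := by
  have h1 := HasLeadingTerm.one.aeval_laguerreOp_mul α (le_refl P.natDegree)
  rw [mul_one, zero_add] at h1
  have h2 : HasLeadingTerm (∑ i ∈ u, aeval (laguerreOp α) (F i) * derivative *
      aeval (laguerreOp α) (R i)) (2 * P.natDegree) 0 0 := by
    refine HasLeadingTerm.sum fun i hi => ?_
    rcases h i hi with h0 | hlt
    · rw [h0, map_zero, zero_mul, zero_mul]; exact HasLeadingTerm.zero _ _
    · have h3 := HasLeadingTerm.one.aeval_laguerreOp_mul α (le_refl (R i).natDegree)
      rw [mul_one] at h3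
      have h4 := (h3.derivative_mul.mono_shift (e' := 0) (by norm_num)).aeval_laguerreOp_mul α
        (le_refl (F i).natDegree)
      rw [← mul_assoc] at h4
      -- The term has order at most `2 (deg F + deg R) + 1`; the extra derivative still leaves it
      -- below `2 deg P`.
      exact h4.mono_order (by omega)
  refine (h1.add h2).isDiffOpOfOrder ?_
  simpa using hP

end OrderOfOperators

section LaguerreEigenfunctions

/-! ### Laguerre polynomials as eigenfunctions -/

lemma coeff_laguerre (α n i : ℕ) :
    (laguerre α n).coeff i =
      (-1) ^ i / (Nat.factorial i : ℝ) * ((n + α).choose (α + i) : ℝ) := by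
  simp only [laguerre, finsetSum_coeff, coeff_C_mul_X_pow]
  rw [Finset.sum_ite_eq]
  split_ifs with h
  · have h' : i ≤ n := by simpa [Nat.lt_succ_iff] using h
    rw [← Nat.choose_symm_of_eq_add (show n + α = (α + i) + (n - i) by omega)]
  · have h' : n < i := by simpa using h
    rw [Nat.choose_eq_zero_of_lt (by omega)]; simp

lemma sum_range_choose_add (α i n : ℕ) :
    ∑ k ∈ Finset.range n, (k + α).choose (α + i) = (n + α).choose (α + i + 1) := by
  induction n with
  | zero => rw [Nat.choose_eq_zero_of_lt (by omega)]; rfl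
  | succ n ih =>
    rw [Finset.sum_range_succ, ih, show n + 1 + α = (n + α) + 1 by ring, Nat.choose_succ_succ,
      add_comm]

/-- Coefficientwise this is the hockey-stick identity. -/
lemma derivative_laguerre (α n : ℕ) :
    derivative (laguerre α n) = -∑ k ∈ Finset.range n, laguerre α k := by
  ext i
  rw [coeff_derivative, coeff_neg, finsetSum_coeff]
  simp only [coeff_laguerre]
  rw [← Finset.mul_sum, ← Nat.cast_sum, sum_range_choose_add, Nat.factorial_succ, pow_succ,
    add_assoc]
  have : (Nat.factorial i : ℝ) ≠ 0 := by positivity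
  push_cast
  field_simp

lemma laguerreOp_laguerre (α n : ℕ) :
    laguerreOp α (laguerre α n) = (n : ℝ) • laguerre α n := by
  -- The Laguerre equation is this two-term recurrence for the coefficients.
  have key : ∀ i : ℕ, ((i : ℝ) + 1) * (i + α + 1) * (laguerre α n).coeff (i + 1) =
      ((i : ℝ) - n) * (laguerre α n).coeff i := by
    intro i
    rw [coeff_laguerre, coeff_laguerre]
    have h := Nat.choose_succ_right_eq (n + α) (α + i)
    have h' : ((n + α).choose (α + (i + 1)) : ℝ) * (α + i + 1) =
        (n + α).choose (α + i) * ((n : ℝ) - i) := by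
      rcases le_or_gt i n with hi | hi
      · have : n + α - (α + i) = n - i := by omega
        rw [this] at h
        have h2 := congrArg (Nat.cast : ℕ → ℝ) h
        push_cast [Nat.cast_sub hi] at h2
        exact h2
      · rw [Nat.choose_eq_zero_of_lt (by omega), Nat.choose_eq_zero_of_lt (by omega)]; simp
    have : (Nat.factorial i : ℝ) ≠ 0 := by positivity
    rw [Nat.factorial_succ, pow_succ]
    push_cast
    field_simp
    linear_combination (-1) * h'
  have e1 : laguerreOp α (laguerre α n) = -(X * derivative (derivative (laguerre α n))) -
      (C ((α : ℝ) + 1) - X) * derivative (laguerre α n) := rfl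
  rw [e1]
  ext i
  rw [coeff_smul, smul_eq_mul, sub_mul, coeff_sub, coeff_neg, coeff_sub, coeff_C_mul]
  have hk := key i
  rcases i with _ | i
  · simp only [mul_coeff_zero, coeff_X_zero, coeff_derivative]
    push_cast at hk ⊢
    linear_combination (-1) * hk
  · simp only [coeff_X_mul, coeff_derivative]
    push_cast at hk ⊢
    linear_combination (-1) * hk

lemma aeval_laguerreOp_laguerre (α n : ℕ) (p : ℝ[X]) :
    aeval (laguerreOp α) p (laguerre α n) = p.eval (n : ℝ) • laguerre α n := by
  have h : ∀ k : ℕ, (laguerreOp α ^ k) (laguerre α n) = ((n : ℝ) ^ k) • laguerre α n := by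
    intro k
    induction k with
    | zero => simp
    | succ k ih => rw [pow_succ, Module.End.mul_apply, laguerreOp_laguerre, map_smul, ih,
        smul_smul, pow_succ']
  induction p using Polynomial.induction_on' with
  | add p q hp hq => simp [hp, hq, add_smul]
  | monomial k a =>
    rw [aeval_monomial, Module.End.mul_apply, h, Algebra.algebraMap_eq_smul_one, eval_monomial,
      LinearMap.smul_apply, Module.End.one_apply, smul_smul]

lemma degree_laguerre (α n : ℕ) : (laguerre α n).natDegree ≤ n :=
  natDegree_le_iff_coeff_eq_zero.mpr fun i hi => by
    rw [coeff_laguerre, Nat.choose_eq_zero_of_lt (by omega)]; simp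

lemma coeff_laguerre_self_ne_zero (α n : ℕ) : (laguerre α n).coeff n ≠ 0 := by
  rw [coeff_laguerre, add_comm α n, Nat.choose_self]
  simp [Nat.factorial_ne_zero]

/-- The operator acts on Laguerre polynomials by a lower triangular kernel. -/
lemma aeval_derivative_aeval_laguerre (α n : ℕ) (p q : ℝ[X]) :
    (aeval (laguerreOp α) p * derivative * aeval (laguerreOp α) q : Module.End ℝ ℝ[X]) (laguerre α n) =
      -∑ k ∈ Finset.range n, (p.eval (k : ℝ) * q.eval (n : ℝ)) • laguerre α k := by
  rw [Module.End.mul_apply, Module.End.mul_apply, aeval_laguerreOp_laguerre,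
    LinearMap.map_smul, derivative_laguerre]
  simp only [map_smul, map_neg, map_sum, aeval_laguerreOp_laguerre, smul_neg, Finset.smul_sum,
    smul_smul]
  congr 1
  exact Finset.sum_congr rfl fun k _ => by rw [mul_comm]

end LaguerreEigenfunctions

section EigenvalueEquation

/-! ### The eigenvalue equation -/

variable {m : ℕ}

/-- The kernel `∑_h M_h(y) R_h(z)`. -/
def kernelSum (R : Fin m → ℝ[X]) (S : ℝ[X]) (z y : ℝ) : ℝ :=
  ∑ h, (minorSum R S h).eval y * (R h).eval z

/-- The determinant of the Casorati matrix at `y` with column `j` replaced by `R(z)`. -/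
def cramerKernel (R : Fin m → ℝ[X]) (j : Fin m) (y z : ℝ) : ℝ :=
  ∑ h, ((casoratiMatrix R).adjugate j h).eval y * (R h).eval z

lemma kernelSum_eq (R : Fin m → ℝ[X]) (S : ℝ[X]) (z y : ℝ) :
    kernelSum R S z y =
      ∑ j : Fin m, S.eval (y + (j + 1)) * cramerKernel R j (y + (j + 1)) z := by
  simp only [kernelSum, minorSum, cramerKernel, eval_finsetSum, taylor_eval, eval_mul,
    Finset.sum_mul, Finset.mul_sum]
  rw [Finset.sum_comm]
  refine Finset.sum_congr rfl fun j _ => Finset.sum_congr rfl fun h _ => ?_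
  rw [mul_assoc, add_comm y]

/-- At this point the replacing column equals column `k` of the matrix: for `k ≠ j` a column is
repeated, for `k = j` nothing changes. -/
lemma cramerKernel_shift (R : Fin m → ℝ[X]) (j k : Fin m) (y : ℝ) :
    cramerKernel R j y (y - (k + 1)) = if j = k then (casoratiMatrix R).det.eval y else 0 := by
  have h := congrArg (eval y) (congrFun (congrFun (casoratiMatrix R).adjugate_mul j) k)
  rw [Matrix.mul_apply, eval_finsetSum] at h
  simp only [casoratiMatrix, Matrix.of_apply, eval_mul, taylor_eval] at h
  have e : ∀ a : ℝ, y - a = y + -a := fun a => by ring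
  unfold cramerKernel casoratiMatrix
  simp only [e]
  rw [h, Matrix.smul_apply, Matrix.one_apply]
  split_ifs <;> simp

/-- Abstract form of the cofactor identity: if `b_0, …, b_m` annihilates the values
`R_h(x - i)`, then it solves the triangular eigenvalue system. -/
lemma sum_mul_kernelSum (R : Fin m → ℝ[X]) (S : ℝ[X]) (b : ℕ → ℝ) (x : ℝ)
    (hb : ∀ h, ∑ i ∈ Finset.range (m + 1), b i * (R h).eval (x - i) = 0) {r : ℕ} (hr : r ≤ m) :
    ∑ i ∈ Finset.range r, b i * kernelSum R S (x - i) (x - r) =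
      -(b r * ∑ j ∈ Finset.range r, (S * (casoratiMatrix R).det).eval (x - r + (j + 1))) := by
  have hG : ∀ (j : Fin m) (y : ℝ),
      ∑ i ∈ Finset.range (m + 1), b i * cramerKernel R j y (x - i) = 0 := by
    intro j y
    simp only [cramerKernel, Finset.mul_sum]
    rw [Finset.sum_comm]
    refine Finset.sum_eq_zero fun h _ => ?_
    rw [← mul_zero (((casoratiMatrix R).adjugate j h).eval y), ← hb h, Finset.mul_sum]
    exact Finset.sum_congr rfl fun i _ => by ring
  -- The point `x - i` is the shift belonging to column `i + j - r` of the Casorati matrix at `x - r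
  -- + (j + 1)`; this is column `j` exactly when `i = r`.
  have hshift : ∀ (j : Fin m) (i : ℕ), r ≤ i + j → i + j < r + m →
      cramerKernel R j (x - r + (j + 1)) (x - i) =
        if i = r then (casoratiMatrix R).det.eval (x - r + (j + 1)) else 0 := by
    intro j i h1 h2
    have h3 := cramerKernel_shift R j ⟨i + j - r, by omega⟩ (x - r + (j + 1))
    have h4 : x - r + ((j : ℝ) + 1) - (((i + j - r : ℕ) : ℝ) + 1) = x - i := by
      rw [Nat.cast_sub h1]; push_cast; ring
    rw [h4] at h3
    rw [h3]
    congr 1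
    rw [Fin.ext_iff]
    simp only [eq_iff_iff]
    omega
  -- If `j < r`, all indices above `r` lie in the window of `hshift` and vanish, so the annihilation
  -- relation leaves minus the term `i = r`. If `j ≥ r`, all indices below `r` lie in the window and
  -- vanish directly.
  have hinner : ∀ j : Fin m,
      ∑ i ∈ Finset.range r, b i * cramerKernel R j (x - r + (j + 1)) (x - i) =
        if (j : ℕ) < r then -(b r * (casoratiMatrix R).det.eval (x - r + (j + 1))) else 0 := by
    intro j
    split_ifs with hj
    · have h1 := hG j (x - r + (j + 1))
      rw [← Finset.sum_range_add_sum_Ico _ (show r ≤ m + 1 by omega),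
        Finset.sum_eq_sum_Ico_succ_bot (show r < m + 1 by omega),
        Finset.sum_eq_zero (s := Finset.Ico (r + 1) (m + 1))] at h1
      · rw [hshift j r (by omega) (by omega), if_pos rfl] at h1
        linarith
      · intro i hi
        rw [Finset.mem_Ico] at hi
        rw [hshift j i (by omega) (by omega), if_neg (by omega), mul_zero]
    · refine Finset.sum_eq_zero fun i hi => ?_
      rw [Finset.mem_range] at hi
      rw [hshift j i (by omega) (by omega), if_neg (by omega), mul_zero]
  simp only [kernelSum_eq, Finset.mul_sum]
  rw [Finset.sum_comm]
  have h1 : ∀ j : Fin m, ∑ i ∈ Finset.range r, b i * (S.eval (x - r + (j + 1)) *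
      cramerKernel R j (x - r + (j + 1)) (x - i)) = (fun j : ℕ => if j < r then
        -(b r * (S * (casoratiMatrix R).det).eval (x - r + (j + 1))) else 0) j := by
    intro j
    calc _ = S.eval (x - r + (j + 1)) *
        ∑ i ∈ Finset.range r, b i * cramerKernel R j (x - r + (j + 1)) (x - i) := by
          rw [Finset.mul_sum]; exact Finset.sum_congr rfl fun i _ => by ring
      _ = _ := by
        rw [hinner]
        dsimp only
        split_ifs
        · rw [eval_mul]; ring
        · rw [mul_zero]
  rw [Finset.sum_congr rfl fun j _ => h1 j, Fin.sum_univ_eq_sum_range (fun j : ℕ => if j < r then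
        -(b r * (S * (casoratiMatrix R).det).eval (x - r + (j + 1))) else 0) m,
    ← Finset.sum_subset (Finset.range_subset_range.mpr hr), ← Finset.sum_neg_distrib]
  · exact Finset.sum_congr rfl fun j hj => by rw [if_pos (Finset.mem_range.mp hj)]
  · intro j _ hj
    rw [if_neg (by simpa using hj)]

lemma eval_add_natCast_sub_eval {P Q : ℝ[X]} (h : P - P.comp (X - 1) = Q) (x : ℝ) (r : ℕ) :
    P.eval (x + r) - P.eval x = ∑ j ∈ Finset.range r, Q.eval (x + (j + 1)) := by
  induction r with
  | zero => simp
  | succ r ih =>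
    rw [Finset.sum_range_succ, ← ih, ← h]
    simp only [eval_sub, eval_comp, eval_X, eval_one]
    push_cast
    rw [show x + ((r : ℝ) + 1) - 1 = x + r by ring]
    ring

/-! ### Action of the operator on Laguerre expansions -/

/-- The Laguerre polynomial of degree `n - i`, or zero if `n < i`. -/
def laguerreSub (α n i : ℕ) : ℝ[X] := if i ≤ n then laguerre α (n - i) else 0

/-- The operator `P(D_α) + ∑_h M_h(D_α) ∘ d/dx ∘ R_h(D_α)` for a general family `R`. -/
def kernelOp (α : ℕ) (R : Fin m → ℝ[X]) (S P : ℝ[X]) : Module.End ℝ ℝ[X] :=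
  aeval (laguerreOp α) P +
    ∑ h, aeval (laguerreOp α) (minorSum R S h) * derivative * aeval (laguerreOp α) (R h)

lemma sobolevOp_eq (α : ℕ) (M : Matrix (Fin m) (Fin m) ℝ) (S P : ℝ[X]) :
    sobolevOp α M S P = kernelOp α (calR α M) S P := by
  unfold sobolevOp kernelOp
  simp only [auxPoly_eq]
  rfl

lemma kernelOp_laguerre (α : ℕ) (R : Fin m → ℝ[X]) (S P : ℝ[X]) (n : ℕ) :
    kernelOp α R S P (laguerre α n) = P.eval (n : ℝ) • laguerre α n -
      ∑ k ∈ Finset.range n, kernelSum R S n k • laguerre α k := by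
  rw [kernelOp, LinearMap.add_apply, LinearMap.sum_apply, aeval_laguerreOp_laguerre]
  simp only [aeval_derivative_aeval_laguerre, kernelSum, Finset.sum_smul]
  rw [Finset.sum_neg_distrib, Finset.sum_comm, sub_eq_add_neg]

lemma kernelOp_laguerreSub (α : ℕ) (R : Fin m → ℝ[X]) (S P : ℝ[X]) {n i N : ℕ} (hN : n < N) :
    kernelOp α R S P (laguerreSub α n i) = P.eval ((n : ℝ) - i) • laguerreSub α n i -
      ∑ r ∈ Finset.range N, (if i < r then kernelSum R S (n - i) (n - r) else 0) •
        laguerreSub α n r := by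
  by_cases hi : i ≤ n
  · have h1 : laguerreSub α n i = laguerre α (n - i) := if_pos hi
    rw [h1, kernelOp_laguerre, Nat.cast_sub hi]
    congr 1
    symm
    rw [← Finset.sum_subset (s₁ := Finset.Ioc i n)]
    · refine Finset.sum_nbij' (fun r => n - r) (fun k => n - k) ?_ ?_ ?_ ?_ ?_
      · intro r hr; simp only [Finset.mem_Ioc, Finset.mem_range] at *; omega
      · intro r hr; simp only [Finset.mem_Ioc, Finset.mem_range] at *; omega
      · intro r hr; simp only [Finset.mem_Ioc] at *; omega
      · intro r hr; simp only [Finset.mem_range] at *; omega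
      · intro r hr
        rw [Finset.mem_Ioc] at hr
        rw [if_pos hr.1, laguerreSub, if_pos hr.2, Nat.cast_sub hr.2]
    · intro r hr; simp only [Finset.mem_Ioc, Finset.mem_range] at *; omega
    · intro r _ hr
      rw [Finset.mem_Ioc, not_and_or, not_lt, not_le] at hr
      rcases hr with hr | hr
      · rw [if_neg (by omega), zero_smul]
      · rw [laguerreSub, if_neg (show ¬ r ≤ n by omega), smul_zero]
  · rw [laguerreSub, if_neg hi, map_zero, smul_zero, Finset.sum_eq_zero, sub_zero]
    intro r _
    split_ifs with hr
    · rw [laguerreSub, if_neg (show ¬ r ≤ n by omega), smul_zero]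
    · rw [zero_smul]

/-- Compare coefficients at each `laguerreSub α n r`. For `r ≤ m` the kernel sum telescopes to `P(n)
- P(n - r)`; for `r > m` it runs over all nonzero `b i`, and the annihilation relation kills it. -/
lemma kernelOp_eigen (α : ℕ) (R : Fin m → ℝ[X]) {S P : ℝ[X]}
    (hP : P - P.comp (X - 1) = S * (casoratiMatrix R).det) (n : ℕ) (b : ℕ → ℝ)
    (hb0 : ∀ i, m < i → b i = 0)
    (hb : ∀ h, ∑ i ∈ Finset.range (m + 1), b i * (R h).eval ((n : ℝ) - i) = 0) :
    kernelOp α R S P (∑ i ∈ Finset.range (m + 1), b i • laguerreSub α n i) =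
      P.eval (n : ℝ) • ∑ i ∈ Finset.range (m + 1), b i • laguerreSub α n i := by
  set N := n + m + 1 with hN
  have hext : ∑ i ∈ Finset.range (m + 1), b i • laguerreSub α n i =
      ∑ i ∈ Finset.range N, b i • laguerreSub α n i :=
    Finset.sum_subset (Finset.range_subset_range.mpr (by omega)) fun i _ hi => by
      rw [hb0 i (by simpa [Nat.lt_succ_iff] using hi), zero_smul]
  have hcoef : ∀ r, r < N → b r * P.eval ((n : ℝ) - r) - ∑ i ∈ Finset.range N,
      b i * (if i < r then kernelSum R S (n - i) (n - r) else 0) = P.eval (n : ℝ) * b r := by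
    intro r hr
    have h1 : ∑ i ∈ Finset.range N, b i * (if i < r then kernelSum R S (n - i) (n - r) else 0) =
        ∑ i ∈ Finset.range r, b i * kernelSum R S (n - i) (n - r) := by
      rw [← Finset.sum_subset (Finset.range_subset_range.mpr hr.le)]
      · exact Finset.sum_congr rfl fun i hi => by rw [if_pos (Finset.mem_range.mp hi)]
      · intro i _ hi
        rw [if_neg (by simpa using hi), mul_zero]
    rw [h1]
    rcases le_or_gt r m with hrm | hrm
    · rw [sum_mul_kernelSum R S b n hb hrm, ← eval_add_natCast_sub_eval hP, sub_add_cancel]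
      ring
    · rw [hb0 r hrm, ← Finset.sum_subset (Finset.range_subset_range.mpr hrm)]
      · simp only [kernelSum, Finset.mul_sum]
        rw [Finset.sum_comm, Finset.sum_eq_zero]
        · ring
        · intro h _
          rw [← mul_zero ((minorSum R S h).eval ((n : ℝ) - r)), ← hb h, Finset.mul_sum]
          exact Finset.sum_congr rfl fun i _ => by ring
      · intro i _ hi
        rw [hb0 i (by simpa [Nat.lt_succ_iff] using hi), zero_mul]
  rw [hext, map_sum, Finset.smul_sum]
  simp only [map_smul, kernelOp_laguerreSub α R S P (show n < N by omega), smul_sub,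
    Finset.smul_sum, smul_smul]
  rw [Finset.sum_sub_distrib, Finset.sum_comm, ← Finset.sum_sub_distrib]
  refine Finset.sum_congr rfl fun r hr => ?_
  rw [← hcoef r (Finset.mem_range.mp hr), sub_smul, Finset.sum_smul]

/-- The coefficients of `q_n` with respect to the Laguerre polynomials. -/
def cofactor (R : Fin m → ℝ[X]) (n : ℕ) (j : ℕ) : ℝ :=
  if hj : j < m + 1 then
    (-1) ^ j * (Matrix.of fun i k : Fin m =>
      (R i).eval ((n : ℝ) - ((Fin.succAbove ⟨j, hj⟩ k : Fin (m + 1)) : ℕ))).det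
  else 0

lemma det_cons_eq_sum_cofactor (R : Fin m → ℝ[X]) (n : ℕ) (f : ℕ → ℝ[X]) :
    Matrix.det (Matrix.of (Fin.cons (fun j : Fin (m + 1) => f j)
      (fun (i : Fin m) (j : Fin (m + 1)) => C ((R i).eval ((n : ℝ) - (j : ℝ)))) :
      Fin (m + 1) → Fin (m + 1) → ℝ[X])) =
      ∑ j ∈ Finset.range (m + 1), cofactor R n j • f j := by
  rw [Matrix.det_succ_row_zero, ← Fin.sum_univ_eq_sum_range (fun j => cofactor R n j • f j)]
  refine Finset.sum_congr rfl fun j _ => ?_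
  rw [cofactor, dif_pos j.2, smul_eq_C_mul, C_mul, RingHom.map_det, C_pow, C_neg, C_1]
  simp only [Matrix.of_apply, Fin.cons_zero]
  rw [mul_assoc, mul_assoc, mul_comm (f j)]
  congr

/-- Expansion along the first row of a determinant with a repeated row. -/
lemma sum_cofactor_mul_eval (R : Fin m → ℝ[X]) (n : ℕ) (h : Fin m) :
    ∑ j ∈ Finset.range (m + 1), cofactor R n j * (R h).eval ((n : ℝ) - j) = 0 := by
  have h1 := det_cons_eq_sum_cofactor R n fun j => C ((R h).eval ((n : ℝ) - j))
  rw [Matrix.det_zero_of_row_eq (Fin.succ_ne_zero h).symm] at h1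
  · apply C_injective
    rw [map_sum, C_0, h1]
    exact Finset.sum_congr rfl fun j _ => by rw [smul_eq_C_mul, C_mul]
  · ext1 j
    simp

lemma eval_det_casoratiMatrix (R : Fin m → ℝ[X]) (x : ℝ) :
    (casoratiMatrix R).det.eval x =
      (Matrix.of fun i k : Fin m => (R i).eval (x - ((k : ℝ) + 1))).det := by
  rw [← coe_evalRingHom, RingHom.map_det]
  congr 1
  refine Matrix.ext fun i k => ?_
  simp only [casoratiMatrix, RingHom.mapMatrix_apply, Matrix.map_apply, Matrix.of_apply,
    coe_evalRingHom, taylor_eval]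
  congr 1

lemma cofactor_zero (R : Fin m → ℝ[X]) (n : ℕ) :
    cofactor R n 0 = (casoratiMatrix R).det.eval (n : ℝ) := by
  rw [eval_det_casoratiMatrix, cofactor, dif_pos (Nat.succ_pos m), pow_zero, one_mul]
  congr; ext1 i; ext1 k
  simp

lemma sobolevPoly_eq (α : ℕ) (M : Matrix (Fin m) (Fin m) ℝ) (n : ℕ) :
    sobolevPoly α M n =
      ∑ j ∈ Finset.range (m + 1), cofactor (calR α M) n j • laguerreSub α n j :=
  det_cons_eq_sum_cofactor (calR α M) n (laguerreSub α n)

lemma coeff_laguerreSub_of_pos (α n : ℕ) {i : ℕ} (hi : 0 < i) :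
    (laguerreSub α n i).coeff n = 0 := by
  unfold laguerreSub
  split_ifs with h
  · exact coeff_eq_zero_of_natDegree_lt ((degree_laguerre α (n - i)).trans_lt (by omega))
  · simp

lemma sobolevPoly_ne_zero (α : ℕ) (M : Matrix (Fin m) (Fin m) ℝ) (n : ℕ)
    (h : (casorati α M).eval (n : ℝ) ≠ 0) : sobolevPoly α M n ≠ 0 := by
  intro h0
  have h1 := congrArg (fun p => coeff p n) (sobolevPoly_eq α M n)
  rw [h0] at h1
  simp only [finsetSum_coeff, coeff_smul, smul_eq_mul] at h1
  rw [Finset.sum_range_succ', Finset.sum_eq_zero fun i _ => by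
    rw [coeff_laguerreSub_of_pos α n (Nat.succ_pos i), mul_zero], cofactor_zero, ← casorati_eq,
    coeff_zero, zero_add] at h1
  exact mul_ne_zero h (coeff_laguerre_self_ne_zero α n) h1.symm

lemma sobolevOp_hasEigenvector (α : ℕ) (M : Matrix (Fin m) (Fin m) ℝ) {S P : ℝ[X]}
    (hP : P - P.comp (X - 1) = S * casorati α M) (n : ℕ)
    (h : (casorati α M).eval (n : ℝ) ≠ 0) :
    (sobolevOp α M S P).HasEigenvector (P.eval (n : ℝ)) (sobolevPoly α M n) := by
  refine ⟨?_, sobolevPoly_ne_zero α M n h⟩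
  rw [Module.End.mem_eigenspace_iff, sobolevOp_eq, sobolevPoly_eq]
  rw [casorati_eq] at hP
  exact kernelOp_eigen α _ hP n _ (fun i hi => dif_neg (by omega)) (sum_cofactor_mul_eval _ n)

end EigenvalueEquation

section WeightedRank

/-! ### The weighted rank as a degree -/

/-- Prepending a vector raises the dimension by one exactly when it lies outside the span of the
later ones. -/
lemma finrank_span_range_eq_sum {V : Type*} [AddCommGroup V] [Module ℝ V] [Module.Finite ℝ V] :
    ∀ {m : ℕ} (v : Fin m → V) [DecidablePred fun r => v r ∈ Submodule.span ℝ (v '' Set.Ioi r)],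
      Module.finrank ℝ (Submodule.span ℝ (Set.range v)) =
        ∑ r, if v r ∉ Submodule.span ℝ (v '' Set.Ioi r) then 1 else 0 := by
  intro m
  induction m with
  | zero => intro v _; simp
  | succ m ih =>
    intro v _
    have h1 : v '' Set.Ioi 0 = Set.range fun r : Fin m => v r.succ := by
      ext x
      constructor
      · rintro ⟨i, hi, rfl⟩
        exact ⟨i.pred (ne_of_gt hi), by simp⟩
      · rintro ⟨i, rfl⟩
        exact ⟨i.succ, Fin.succ_pos i, rfl⟩
    have h2 : ∀ r : Fin m, v '' Set.Ioi r.succ = (fun r : Fin m => v r.succ) '' Set.Ioi r := by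
      intro r
      rw [← Fin.image_succ_Ioi, Set.image_image]
    have h3 : Set.range v = Set.insert (v 0) (Set.range fun r : Fin m => v r.succ) := by
      ext x
      simp only [Set.mem_range, Set.insert, Set.mem_ofPred_eq, Fin.exists_fin_succ, eq_comm]
    classical
    rw [Fin.sum_univ_succ]
    simp only [h1, h2]
    rw [← ih fun r : Fin m => v r.succ, h3]
    change Module.finrank ℝ (Submodule.span ℝ (insert (v 0) _)) = _
    rw [Submodule.span_insert]
    split_ifs with h
    · rw [zero_add, sup_eq_right.mpr ((Submodule.span_singleton_le_iff_mem _ _).mpr h)]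
    · rw [sup_comm, Submodule.finrank_sup_span_singleton h, add_comm]

variable {m : ℕ}

lemma span_range_col_pivotMatrix (M : Matrix (Fin m) (Fin m) ℝ) :
    Submodule.span ℝ (Set.range (pivotMatrix M).col) = Submodule.span ℝ (Set.range M.col) := by
  apply le_antisymm
  · refine Submodule.span_mono ?_
    rintro _ ⟨c, rfl⟩
    exact ⟨c, rfl⟩
  · rw [Submodule.span_le]
    rintro _ ⟨c, rfl⟩
    induction c using WellFoundedGT.induction with
    | _ c ih =>
      by_cases hc : IsPivotCol M c
      · exact Submodule.subset_span ⟨⟨c, hc⟩, rfl⟩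
      · have h1 : Submodule.span ℝ (M.col '' Set.Ioi c) ≤
            Submodule.span ℝ (Set.range (pivotMatrix M).col) := by
          rw [Submodule.span_le]
          rintro _ ⟨d, hd, rfl⟩
          exact ih d hd
        exact h1 (not_not.mp hc)

/-- Row `r` of the pivot matrix is a combination of the rows below it. -/
def IsDependentRow (M : Matrix (Fin m) (Fin m) ℝ) (r : Fin m) : Prop :=
  (pivotMatrix M).row r ∈ Submodule.span ℝ ((pivotMatrix M).row '' Set.Ioi r)

open Classical in
-- The pivot columns span the column space, so the pivot matrix has the rank of `M`. Pivots count
-- the rank by columns; independent rows of the pivot matrix count the same rank by rows.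
lemma card_pivot_add_card_dependent (M : Matrix (Fin m) (Fin m) ℝ) :
    Fintype.card {c // IsPivotCol M c} + Fintype.card {r // IsDependentRow M r} = m := by
  have h1 : Fintype.card {c // IsPivotCol M c} = M.rank := by
    rw [Matrix.rank_eq_finrank_span_cols, finrank_span_range_eq_sum, Fintype.card_subtype,
      Finset.card_filter]
    exact Finset.sum_congr rfl fun i _ => if_congr Iff.rfl rfl rfl
  have h2 : Fintype.card {r // ¬ IsDependentRow M r} = (pivotMatrix M).rank := by
    rw [Matrix.rank_eq_finrank_span_row, finrank_span_range_eq_sum, Fintype.card_subtype,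
      Finset.card_filter]
    exact Finset.sum_congr rfl fun i _ => if_congr Iff.rfl rfl rfl
  have h3 : (pivotMatrix M).rank = M.rank := by
    rw [Matrix.rank_eq_finrank_span_cols, Matrix.rank_eq_finrank_span_cols,
      span_range_col_pivotMatrix]
  rw [h1, ← h3, ← h2, add_comm, Fintype.card_subtype_compl, Fintype.card_fin]
  have := Fintype.card_subtype_le (IsDependentRow M)
  rw [Fintype.card_fin] at this
  omega

/-- A linear functional separating the pivot column from the span of the later columns, written as a
row vector. -/
lemma IsPivotCol.exists_vecMul {M : Matrix (Fin m) (Fin m) ℝ} {c : Fin m} (hc : IsPivotCol M c) :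
    ∃ w : Fin m → ℝ, Matrix.vecMul w M c ≠ 0 ∧ ∀ i, c < i → Matrix.vecMul w M i = 0 := by
  obtain ⟨f, hf, hf'⟩ := Submodule.exists_dual_map_eq_bot_of_notMem hc inferInstance
  have h : ∀ i, Matrix.vecMul (fun l => f (Pi.single l 1)) M i = f (M.col i) := by
    intro i
    rw [LinearMap.pi_apply_eq_sum_univ f (M.col i)]
    simp only [Matrix.vecMul, dotProduct, Matrix.col_apply, smul_eq_mul]
    refine Finset.sum_congr rfl fun l _ => ?_
    rw [mul_comm]
    congr 2
    ext k
    simp [Pi.single_apply, eq_comm]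
  refine ⟨fun l => f (Pi.single l 1), by rwa [h], fun i hi => ?_⟩
  rw [h]
  have : f (M.col i) ∈ Submodule.map f (Submodule.span ℝ (M.col '' Set.Ioi c)) :=
    Submodule.mem_map_of_mem (Submodule.subset_span ⟨i, hi, rfl⟩)
  rw [hf'] at this
  simpa using this

/-- The dependence relation kills every pivot column, and hence every column of `M`, since the pivot
columns span them all. -/
lemma IsDependentRow.exists_vecMul {M : Matrix (Fin m) (Fin m) ℝ} {r : Fin m}
    (hr : IsDependentRow M r) :
    ∃ w : Fin m → ℝ, w r = 1 ∧ (∀ l, l < r → w l = 0) ∧ Matrix.vecMul w M = 0 := by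
  obtain ⟨l, hl, hl'⟩ := (Finsupp.mem_span_image_iff_linearCombination ℝ).mp hr
  have hsupp : ∀ i, i ≤ r → l i = 0 := by
    intro i hi
    by_contra h0
    exact absurd (hl (Finsupp.mem_support_iff.mpr h0)) (not_lt.mpr hi)
  refine ⟨(Pi.single r 1 : Fin m → ℝ) - ⇑l, ?_, ?_, ?_⟩
  · simp [hsupp r le_rfl]
  · intro i hi
    simp [hsupp i hi.le, hi.ne]
  · have h1 : ∀ x ∈ Submodule.span ℝ (Set.range M.col), ((Pi.single r 1 : Fin m → ℝ) - ⇑l) ⬝ᵥ x = 0 := by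
      rw [← span_range_col_pivotMatrix]
      intro x hx
      induction hx using Submodule.span_induction with
      | mem x hx =>
        obtain ⟨c, rfl⟩ := hx
        have h2 := congrFun hl' c
        rw [Finsupp.linearCombination_apply, Finsupp.sum_fintype _ _ (by simp)] at h2
        simp only [Finset.sum_apply, Pi.smul_apply, Matrix.row_apply, smul_eq_mul] at h2
        rw [sub_dotProduct, single_dotProduct, one_mul, Matrix.col_apply, ← h2]
        simp [dotProduct]
      | zero => simp
      | add x y _ _ hx hy => rw [dotProduct_add, hx, hy, add_zero]
      | smul a x _ hx => rw [dotProduct_smul, hx, smul_zero]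
    ext c
    exact h1 _ (Submodule.subset_span ⟨c, rfl⟩)

/-! ### Degrees of linear combinations of the polynomials `ℛ_l` -/

lemma degLE_poch (a : ℝ) (k : ℕ) : DegLE (poch a k) k ∧ zcoeff (poch a k) k = 1 := by
  have h1 : DegLE (ascPochhammer ℝ k) k := degLE_natCast_iff.mpr (ascPochhammer_natDegree ℝ k).le
  have h2 := h1.taylor a
  rw [taylor_apply] at h2
  refine ⟨h2.1, ?_⟩
  have h3 := (monic_ascPochhammer ℝ k).coeff_natDegree
  rw [ascPochhammer_natDegree] at h3
  exact h2.2.trans (by rw [zcoeff_natCast, h3])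

/-- The combination of the polynomials `ℛ_l` with coefficients `w_l / l!`. -/
def combR (α : ℕ) (M : Matrix (Fin m) (Fin m) ℝ) (w : Fin m → ℝ) : ℝ[X] :=
  ∑ l : Fin m, (w l / (Nat.factorial l : ℝ)) • calR α M l

lemma combR_eq (α : ℕ) (M : Matrix (Fin m) (Fin m) ℝ) (w : Fin m → ℝ) :
    combR α M w = ∑ l : Fin m, C (w l / (Nat.factorial l : ℝ) *
        ((Nat.factorial (α - m + l) : ℝ) / Nat.factorial (m - 1 - l))) * poch 1 (m - 1 - l) +
      poch 1 α * ∑ i : Fin m, C ((-1) ^ (i : ℕ) * Matrix.vecMul w M i /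
        (Nat.factorial (α + i) : ℝ)) * poch (1 - i) i := by
  have h1 : ∀ l : Fin m, (w l / (Nat.factorial l : ℝ)) • calR α M l =
      C (w l / (Nat.factorial l : ℝ) *
        ((Nat.factorial (α - m + l) : ℝ) / Nat.factorial (m - 1 - l))) * poch 1 (m - 1 - l) +
      poch 1 α * ∑ i : Fin m, C ((-1) ^ (i : ℕ) * (w l * M l i) /
        (Nat.factorial (α + i) : ℝ)) * poch (1 - i) i := by
    intro l
    have h2 : ∀ i : Fin m, C ((-1) ^ (i : ℕ) * (w l * M l i) / (Nat.factorial (α + i) : ℝ)) =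
        C (w l) * C ((-1) ^ (i : ℕ) * M l i / (Nat.factorial (α + i) : ℝ)) := fun i => by
      rw [← C_mul]; congr 1; ring
    have h3 : C (w l / (Nat.factorial l : ℝ)) * C (Nat.factorial l : ℝ) = C (w l) := by
      rw [← C_mul, div_mul_cancel₀ _ (by positivity)]
    rw [calR, smul_eq_C_mul, mul_add, C_mul, ← mul_assoc, ← mul_assoc, ← mul_assoc, h3]
    simp only [h2, mul_assoc, ← Finset.mul_sum]
    ring
  unfold combR
  rw [Finset.sum_congr rfl fun l _ => h1 l, Finset.sum_add_distrib, ← Finset.mul_sum,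
    Finset.sum_comm]
  congr 2
  refine Finset.sum_congr rfl fun i _ => ?_
  rw [← Finset.sum_mul, ← map_sum, ← Finset.sum_div, ← Finset.mul_sum]
  rfl

/-- The part involving `M` has degree `α` plus the last index where `w M` is nonzero; the other part
has degree at most `m - 1 < α` and cannot interfere. -/
lemma degLE_combR_of_pivot {α : ℕ} (hα : m ≤ α) {M : Matrix (Fin m) (Fin m) ℝ} {w : Fin m → ℝ}
    {c : Fin m} (hc : Matrix.vecMul w M c ≠ 0) (hw : ∀ i, c < i → Matrix.vecMul w M i = 0) :
    DegLE (combR α M w) ((α : ℤ) + (c : ℕ)) ∧ zcoeff (combR α M w) ((α : ℤ) + (c : ℕ)) ≠ 0 := by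
  rw [combR_eq]
  have hm := c.pos
  have h1 : DegLE (∑ l : Fin m, C (w l / (Nat.factorial l : ℝ) *
      ((Nat.factorial (α - m + l) : ℝ) / Nat.factorial (m - 1 - l))) * poch 1 (m - 1 - l))
      ((m : ℤ) - 1) :=
    DegLE.sum fun l _ => ((degLE_poch _ _).1.mono (by omega)).C_mul _
  set F : Fin m → ℝ[X] := fun i => C ((-1) ^ (i : ℕ) * Matrix.vecMul w M i /
        (Nat.factorial (α + i) : ℝ)) * poch (1 - i) i with hF
  have h2 : DegLE (∑ i, F i) (c : ℕ) := DegLE.sum fun i _ => by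
    rcases le_or_gt i c with hi | hi
    · exact ((degLE_poch _ _).1.mono (by exact_mod_cast hi)).C_mul _
    · simpa [hF, hw i hi] using degLE_zero _
  have h3 : zcoeff (∑ i, F i) (c : ℕ) ≠ 0 := by
    rw [zcoeff_sum, Finset.sum_eq_single c]
    · rw [hF]
      dsimp only
      rw [zcoeff_C_mul, (degLE_poch _ _).2, mul_one]
      have : (Nat.factorial (α + c) : ℝ) ≠ 0 := by positivity
      exact div_ne_zero (mul_ne_zero (by simp) hc) this
    · intro i _ hic
      rcases lt_or_gt_of_ne hic with hi | hi
      · exact DegLE.zcoeff_eq_zero ((degLE_poch _ _).1.C_mul _) (by exact_mod_cast hi)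
      · simp [hF, hw i hi, zcoeff]
    · simp
  have h4 := degLE_poch 1 α
  refine ⟨(h1.mono (by omega)).add (h4.1.mul h2), ?_⟩
  rw [zcoeff_add, h1.zcoeff_eq_zero (by omega), zero_add, zcoeff_mul h4.1 h2, h4.2, one_mul]
  exact h3

/-- Since `w M = 0`, only the terms of degree `m - 1 - l` survive, and the smallest index in the
support of `w` dominates. -/
lemma degLE_combR_of_dependent {α : ℕ} {M : Matrix (Fin m) (Fin m) ℝ} {w : Fin m → ℝ}
    {r : Fin m} (hr : w r ≠ 0) (hw : ∀ l, l < r → w l = 0) (hM : Matrix.vecMul w M = 0) :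
    DegLE (combR α M w) ((m : ℤ) - 1 - (r : ℕ)) ∧
      zcoeff (combR α M w) ((m : ℤ) - 1 - (r : ℕ)) ≠ 0 := by
  have hm := r.2
  have e : ∀ l : Fin m, ((m - 1 - (l : ℕ) : ℕ) : ℤ) = (m : ℤ) - 1 - (l : ℕ) := fun l => by
    have := l.2; omega
  rw [combR_eq]
  simp only [hM, Pi.zero_apply, mul_zero, zero_div, C_0, zero_mul, Finset.sum_const_zero, add_zero]
  constructor
  · refine DegLE.sum fun l _ => ?_
    rcases lt_or_ge l r with hl | hl
    · simpa [hw l hl] using degLE_zero _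
    · exact ((degLE_poch _ _).1.mono (by have : (r : ℕ) ≤ l := hl; omega)).C_mul _
  · rw [zcoeff_sum, Finset.sum_eq_single r]
    · rw [zcoeff_C_mul, ← e, (degLE_poch _ _).2, mul_one]
      have := Nat.factorial_ne_zero
      refine mul_ne_zero (div_ne_zero hr ?_) (div_ne_zero ?_ ?_) <;> exact_mod_cast this _
    · intro l _ hl
      rcases lt_or_gt_of_ne hl with hl | hl
      · simp [hw l hl, zcoeff]
      · exact DegLE.zcoeff_eq_zero ((degLE_poch _ _).1.C_mul _)
          (by have : (r : ℕ) < l := hl; have := l.2; omega)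
    · simp

/-- Polynomials of different degrees are linearly independent, so the matrix expressing them
through other polynomials is invertible. -/
lemma det_ne_zero_of_injective_degree (A : Matrix (Fin m) (Fin m) ℝ) (R : Fin m → ℝ[X])
    {a : Fin m → ℤ} (ha : Function.Injective a) (h : ∀ i, DegLE (∑ l, A i l • R l) (a i))
    (h0 : ∀ i, zcoeff (∑ l, A i l • R l) (a i) ≠ 0) : A.det ≠ 0 := by
  intro hdet
  obtain ⟨v, hv, hvA⟩ := Matrix.exists_vecMul_eq_zero_iff.mpr hdet
  have hsum : ∑ i, v i • ∑ l, A i l • R l = 0 := by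
    simp only [Finset.smul_sum, smul_smul]
    rw [Finset.sum_comm]
    refine Finset.sum_eq_zero fun l _ => ?_
    rw [← Finset.sum_smul]
    have := congrFun hvA l
    simp only [Matrix.vecMul, dotProduct, Pi.zero_apply] at this
    rw [this, zero_smul]
  obtain ⟨i₀, hi₀⟩ := Function.ne_iff.mp hv
  -- Only the largest degree in the relation contributes to the coefficient at that degree.
  obtain ⟨i, hi, hmax⟩ := Finset.exists_max_image (Finset.univ.filter fun i => v i ≠ 0) a
    ⟨i₀, by simpa using hi₀⟩
  have h1 := congrArg (fun p => zcoeff p (a i)) hsum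
  rw [zcoeff_sum] at h1
  simp only [smul_eq_C_mul (v _), zcoeff_C_mul] at h1
  rw [Finset.sum_eq_single i] at h1
  · have : zcoeff 0 (a i) = 0 := by simp [zcoeff]
    rw [this] at h1
    exact mul_ne_zero (Finset.mem_filter.mp hi).2 (h0 i) h1
  · intro j _ hj
    by_cases hvj : v j = 0
    · rw [hvj, zero_mul]
    · rw [(h j).zcoeff_eq_zero, mul_zero]
      exact lt_of_le_of_ne (hmax j (by simpa using hvj)) fun h => hj (ha h)
  · simp

open Classical in
/-- A basis of the span of the `ℛ_l` with different degrees; their sum determines `awr`. -/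
lemma exists_basis_calR {α : ℕ} (hα : m ≤ α) (M : Matrix (Fin m) (Fin m) ℝ) :
    ∃ (A : Matrix (Fin m) (Fin m) ℝ) (a : Fin m → ℤ), A.det ≠ 0 ∧ Function.Injective a ∧
      (∀ i, DegLE (∑ l, A i l • calR α M l) (a i)) ∧
      (∀ i, zcoeff (∑ l, A i l • calR α M l) (a i) ≠ 0) ∧
      ∑ i, a i - ∑ k : Fin m, ((k : ℕ) : ℤ) = awr α M := by
  choose w₁ hw₁ hw₁' using fun c : {c // IsPivotCol M c} => c.2.exists_vecMul
  choose w₂ hw₂ hw₂' hw₂'' using fun r : {r // IsDependentRow M r} => r.2.exists_vecMul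
  let ι := {c // IsPivotCol M c} ⊕ {r // IsDependentRow M r}
  have hcard : Fintype.card ι = Fintype.card (Fin m) := by
    rw [Fintype.card_sum, card_pivot_add_card_dependent, Fintype.card_fin]
  let e : Fin m ≃ ι := (Fintype.equivOfCardEq hcard).symm
  let w : ι → Fin m → ℝ := Sum.elim w₁ w₂
  let d : ι → ℤ := Sum.elim (fun c => (α : ℤ) + (c.1 : ℕ)) (fun r => (m : ℤ) - 1 - (r.1 : ℕ))
  -- The two families cannot collide: `α + c ≥ m > m - 1 - r`.
  have hd : Function.Injective d := by
    rintro (c | c) (c' | c') h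
    · simp only [d, Sum.elim_inl] at h
      congr 1
      ext
      omega
    · simp only [d, Sum.elim_inl, Sum.elim_inr] at h
      have := c'.1.2
      omega
    · simp only [d, Sum.elim_inl, Sum.elim_inr] at h
      have := c.1.2
      omega
    · simp only [d, Sum.elim_inr] at h
      congr 1
      ext
      omega
  have hdeg : ∀ i : ι, DegLE (combR α M (w i)) (d i) ∧ zcoeff (combR α M (w i)) (d i) ≠ 0 := by
    rintro (c | r)
    · exact degLE_combR_of_pivot hα (hw₁ c) (hw₁' c)
    · exact degLE_combR_of_dependent (by simp [w, hw₂ r]) (hw₂' r) (hw₂'' r)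
  let A : Matrix (Fin m) (Fin m) ℝ :=
    Matrix.of fun i l => w (e i) l / (Nat.factorial (l : ℕ) : ℝ)
  have hA : ∀ i, ∑ l, A i l • calR α M l = combR α M (w (e i)) := fun i => rfl
  have ha : Function.Injective (d ∘ e) := hd.comp e.injective
  refine ⟨A, d ∘ e, det_ne_zero_of_injective_degree A (calR α M) ha (fun i => ?_) (fun i => ?_),
    ha, fun i => ?_, fun i => ?_, ?_⟩
  · rw [hA]; exact (hdeg _).1
  · rw [hA]; exact (hdeg _).2
  · rw [hA]; exact (hdeg _).1
  · rw [hA]; exact (hdeg _).2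
  · have h1 : ∑ i, (d ∘ e) i = ∑ i, d i := Equiv.sum_comp e d
    have h2 : ∀ (p : Fin m → Prop) (f : Fin m → ℤ),
        ∑ c : {c // p c}, f c = ∑ c, if p c then f c else 0 := fun p f => by
      rw [← Finset.sum_filter]
      exact (Finset.sum_subtype _ (by simp) f).symm
    have h3 : ∑ k : Fin m, ((k : ℕ) : ℤ) = (m : ℤ) * (m - 1) / 2 := by
      rw [Fin.sum_univ_eq_sum_range (fun k => (k : ℤ)) m]
      have h4 := Finset.sum_range_id_mul_two m
      have h5 : ((∑ k ∈ Finset.range m, (k : ℤ)) * 2) = (m : ℤ) * (m - 1) := by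
        rcases m with _ | m
        · simp
        · have := congrArg (Nat.cast : ℕ → ℤ) h4
          push_cast at this ⊢
          simpa using this
      omega
    rw [h1, h3, Fintype.sum_sum_type]
    simp only [d, Sum.elim_inl, Sum.elim_inr]
    rw [h2 _ fun c => (α : ℤ) + (c : ℕ), h2 _ fun r => (m : ℤ) - 1 - (r : ℕ)]
    rfl

end WeightedRank

section Orthogonality

/-! ### The bilinear form on monomials and Laguerre polynomials -/

lemma integrableOn_pow_mul_exp_neg (n : ℕ) :
    IntegrableOn (fun x : ℝ => x ^ n * Real.exp (-x)) (Set.Ioi 0) := by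
  have h := Real.GammaIntegral_convergent (s := (n : ℝ) + 1) (by positivity)
  simpa [mul_comm] using h

lemma integral_pow_mul_exp_neg (n : ℕ) :
    ∫ x in Set.Ioi (0 : ℝ), x ^ n * Real.exp (-x) = Nat.factorial n := by
  rw [← Real.Gamma_nat_eq_factorial, Real.Gamma_eq_integral (by positivity)]
  simp [mul_comm]

/-- The moment functional of the weight `x^b e^(-x)` on the half line. -/
def momentFunctional (b : ℕ) : ℝ[X] →ₗ[ℝ] ℝ :=
  lsum fun i => (Nat.factorial (b + i) : ℝ) • LinearMap.id

lemma momentFunctional_C_mul_X_pow (b i : ℕ) (a : ℝ) :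
    momentFunctional b (C a * X ^ i) = a * Nat.factorial (b + i) := by
  rw [momentFunctional, lsum_apply, C_mul_X_pow_eq_monomial, sum_monomial_index _ _ (by simp)]
  simp [mul_comm]

lemma integral_eq_momentFunctional (b : ℕ) (p : ℝ[X]) :
    ∫ x in Set.Ioi (0 : ℝ), p.eval x * (x ^ b * Real.exp (-x)) = momentFunctional b p := by
  have h1 : ∀ x : ℝ, p.eval x * (x ^ b * Real.exp (-x)) =
      ∑ i ∈ p.support, p.coeff i * (x ^ (b + i) * Real.exp (-x)) := by
    intro x
    rw [eval_eq_sum, Polynomial.sum, Finset.sum_mul]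
    exact Finset.sum_congr rfl fun i _ => by ring
  simp only [h1]
  rw [integral_finsetSum]
  · rw [momentFunctional, lsum_apply, Polynomial.sum]
    refine Finset.sum_congr rfl fun i _ => ?_
    rw [integral_const_mul, integral_pow_mul_exp_neg]
    simp [mul_comm]
  · intro i _
    exact (integrableOn_pow_mul_exp_neg (b + i)).const_mul _

lemma momentFunctional_X_pow_mul (b k : ℕ) (p : ℝ[X]) :
    momentFunctional b (X ^ k * p) = momentFunctional (b + k) p := by
  induction p using Polynomial.induction_on' with
  | add p q hp hq => rw [mul_add, map_add, map_add, hp, hq]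
  | monomial i a =>
    rw [← C_mul_X_pow_eq_monomial, momentFunctional_C_mul_X_pow, mul_left_comm, ← pow_add,
      momentFunctional_C_mul_X_pow, add_assoc]

variable {m : ℕ}

lemma sobolevForm_eq (α : ℕ) (M : Matrix (Fin m) (Fin m) ℝ) (p q : ℝ[X]) :
    sobolevForm α M p q = momentFunctional (α - m) (p * q) +
      ∑ i : Fin m, ∑ j : Fin m,
        (derivative^[(i : ℕ)] p).eval 0 * M i j * (derivative^[(j : ℕ)] q).eval 0 := by
  rw [← integral_eq_momentFunctional]
  simp only [eval_mul]
  rfl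

/-- The Laguerre-Sobolev form as a bilinear map. -/
def sobolevBilin (α : ℕ) (M : Matrix (Fin m) (Fin m) ℝ) : ℝ[X] →ₗ[ℝ] ℝ[X] →ₗ[ℝ] ℝ :=
  LinearMap.mk₂ ℝ (sobolevForm α M)
    (fun p p' q => by
      simp only [sobolevForm_eq, add_mul, map_add, iterate_map_add, eval_add,
        Finset.sum_add_distrib]
      ring)
    (fun c p q => by
      simp only [sobolevForm_eq, smul_mul_assoc, map_smul, iterate_derivative_smul, eval_smul,
        smul_eq_mul, mul_add, Finset.mul_sum, mul_assoc])
    (fun p q q' => by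
      simp only [sobolevForm_eq, mul_add, map_add, iterate_map_add, eval_add,
        Finset.sum_add_distrib]
      ring)
    (fun c p q => by
      simp only [sobolevForm_eq, mul_smul_comm, map_smul, iterate_derivative_smul, eval_smul,
        smul_eq_mul, mul_add, Finset.mul_sum]
      congr 1
      exact Finset.sum_congr rfl fun i _ => Finset.sum_congr rfl fun j _ => by ring)

lemma sobolevBilin_apply (α : ℕ) (M : Matrix (Fin m) (Fin m) ℝ) (p q : ℝ[X]) :
    sobolevBilin α M p q = sobolevForm α M p q := rfl

lemma eval_zero_iterate_derivative (p : ℝ[X]) (i : ℕ) :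
    (derivative^[i] p).eval 0 = Nat.factorial i * p.coeff i := by
  rw [← coeff_zero_eq_eval_zero, coeff_iterate_derivative, zero_add, Nat.descFactorial_self,
    nsmul_eq_mul]

lemma sobolevBilin_X_pow_of_lt (α : ℕ) (M : Matrix (Fin m) (Fin m) ℝ) (k : Fin m) (q : ℝ[X]) :
    sobolevBilin α M (X ^ (k : ℕ)) q = momentFunctional (α - m + k) q +
      Nat.factorial k * ∑ j : Fin m, M k j * (Nat.factorial j * q.coeff j) := by
  rw [sobolevBilin_apply, sobolevForm_eq, momentFunctional_X_pow_mul]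
  congr 1
  rw [Finset.sum_eq_single k]
  · simp only [eval_zero_iterate_derivative, Finset.mul_sum, coeff_X_pow, if_true, mul_one]
    exact Finset.sum_congr rfl fun j _ => by ring
  · intro i _ hi
    refine Finset.sum_eq_zero fun j _ => ?_
    rw [eval_zero_iterate_derivative, coeff_X_pow, if_neg (fun h => hi (Fin.ext h))]
    ring
  · simp

lemma sobolevBilin_X_pow_of_le (α : ℕ) (M : Matrix (Fin m) (Fin m) ℝ) {k : ℕ} (hk : m ≤ k)
    (q : ℝ[X]) : sobolevBilin α M (X ^ k) q = momentFunctional (α - m + k) q := by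
  rw [sobolevBilin_apply, sobolevForm_eq, momentFunctional_X_pow_mul, Finset.sum_eq_zero,
    add_zero]
  intro i _
  refine Finset.sum_eq_zero fun j _ => ?_
  rw [eval_zero_iterate_derivative, coeff_X_pow, if_neg (by omega)]
  ring

/-- Chu–Vandermonde, after writing the signed binomial of `b + i` over `i` as the binomial of `-(b +
1)` over `i`. Integer upper arguments cover `b ≥ n + α` as well. -/
lemma momentFunctional_laguerre (b α n : ℕ) :
    momentFunctional b (laguerre α n) =
      Nat.factorial b * ((Ring.choose ((n : ℤ) + α - (b + 1)) n : ℤ) : ℝ) := by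
  have h1 : (n : ℤ) + α - (b + 1) = -((b + 1 : ℕ) : ℤ) + ((n + α : ℕ) : ℤ) := by push_cast; ring
  rw [h1, Ring.add_choose_eq n (Commute.all _ _),
    Finset.Nat.sum_antidiagonal_eq_sum_range_succ (fun i j =>
      Ring.choose (-((b + 1 : ℕ) : ℤ)) i * Ring.choose ((n + α : ℕ) : ℤ) j), laguerre, map_sum,
    Int.cast_sum, Finset.mul_sum]
  refine Finset.sum_congr rfl fun i _ => ?_
  have h2 : Ring.choose (-((b + 1 : ℕ) : ℤ)) i = (-1) ^ i * ((b + i).choose i : ℤ) := by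
    rw [Ring.choose_neg]
    have : ((b + 1 : ℕ) : ℤ) + i - 1 = ((b + i : ℕ) : ℤ) := by push_cast; ring
    rw [this, Ring.choose_natCast, Int.negOnePow_def, zpow_natCast, Units.smul_def]
    simp
  rw [momentFunctional_C_mul_X_pow, h2, Ring.choose_natCast]
  have h3 : ((b + i).choose i : ℝ) * Nat.factorial i * Nat.factorial b =
      Nat.factorial (b + i) := by
    have := Nat.add_choose_mul_factorial_mul_factorial b i
    rw [← this]; push_cast; ring
  have : (Nat.factorial i : ℝ) ≠ 0 := by positivity
  rw [← h3]
  push_cast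
  field_simp

lemma eval_poch_one (k n : ℕ) :
    (poch 1 k).eval (n : ℝ) = Nat.factorial (n + k) / Nat.factorial n := by
  have h := Nat.factorial_mul_ascFactorial n k
  have h' := congrArg (Nat.cast : ℕ → ℝ) h
  rw [Nat.cast_mul, Nat.cast_ascFactorial] at h'
  rw [poch, eval_comp, ← h']
  have : (Nat.factorial n : ℝ) ≠ 0 := by positivity
  field_simp
  simp

lemma eval_poch_sub (i n : ℕ) : (poch (1 - i) i).eval (n : ℝ) = n.descFactorial i := by
  rw [← descPochhammer_eval_eq_descFactorial, descPochhammer_eval_eq_ascPochhammer, poch,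
    eval_comp]
  simp only [eval_add, eval_X, eval_C]
  congr 1; ring

lemma choose_add_eq (α n i : ℕ) :
    ((n + α).choose (α + i) : ℝ) = Nat.factorial (n + α) / Nat.factorial n *
      (n.descFactorial i / Nat.factorial (α + i)) := by
  have : (Nat.factorial n : ℝ) ≠ 0 := by positivity
  have : (Nat.factorial (α + i) : ℝ) ≠ 0 := by positivity
  rcases le_or_gt i n with hi | hi
  · have h1 := Nat.choose_mul_factorial_mul_factorial (show α + i ≤ n + α by omega)
    have h2 := Nat.factorial_mul_descFactorial hi
    rw [show n + α - (α + i) = n - i by omega] at h1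
    have : (Nat.factorial (n - i) : ℝ) ≠ 0 := by positivity
    rw [← h1, ← h2]
    push_cast
    have : (n.descFactorial i : ℝ) ≠ 0 := by
      exact_mod_cast (Nat.pos_of_ne_zero fun h => by
        rw [Nat.descFactorial_eq_zero_iff_lt] at h; omega).ne'
    field_simp
  · rw [Nat.choose_eq_zero_of_lt (by omega), Nat.descFactorial_eq_zero_iff_lt.mpr hi]
    simp

/-- The values of `ℛ_k` at the natural numbers are the products `⟨x^k, L_n⟩`. -/
lemma sobolevBilin_X_pow_laguerre {α : ℕ} (hα : m ≤ α) (M : Matrix (Fin m) (Fin m) ℝ) (k : Fin m)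
    (n : ℕ) : sobolevBilin α M (X ^ (k : ℕ)) (laguerre α n) = (calR α M k).eval (n : ℝ) := by
  have hk := k.2
  rw [sobolevBilin_X_pow_of_lt, momentFunctional_laguerre, calR]
  simp only [eval_add, eval_mul, eval_C, eval_finsetSum, eval_poch_one, eval_poch_sub]
  congr 1
  · have h1 : (n : ℤ) + α - (((α - m + k : ℕ) : ℤ) + 1) = ((n + (m - 1 - k) : ℕ) : ℤ) := by omega
    rw [h1, Ring.choose_natCast]
    have h2 := Nat.add_choose_mul_factorial_mul_factorial n (m - 1 - k)
    rw [Nat.choose_symm_add, ← h2]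
    have : (Nat.factorial n : ℝ) ≠ 0 := by positivity
    have : (Nat.factorial (m - 1 - k) : ℝ) ≠ 0 := by positivity
    push_cast
    field_simp
  · rw [mul_assoc, Finset.mul_sum (a := (Nat.factorial (n + α) : ℝ) / Nat.factorial n)]
    congr 1
    refine Finset.sum_congr rfl fun i _ => ?_
    rw [coeff_laguerre, choose_add_eq]
    have : (Nat.factorial (i : ℕ) : ℝ) ≠ 0 := by positivity
    field_simp

/-- The upper binomial argument is `n + m - (k + 1)`, which lies between `0` and `n - 1`. -/
lemma sobolevBilin_X_pow_laguerre_eq_zero {α : ℕ} (hα : m ≤ α) (M : Matrix (Fin m) (Fin m) ℝ)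
    {k n : ℕ} (hk : m ≤ k) (hkn : k < m + n) :
    sobolevBilin α M (X ^ k) (laguerre α n) = 0 := by
  rw [sobolevBilin_X_pow_of_le α M hk, momentFunctional_laguerre]
  have h1 : (n : ℤ) + α - (((α - m + k : ℕ) : ℤ) + 1) = ((n + m - (k + 1) : ℕ) : ℤ) := by omega
  rw [h1, Ring.choose_natCast, Nat.choose_eq_zero_of_lt (by omega)]
  simp

/-! ### Orthogonal polynomials and the Casorati determinant -/

lemma eval_poch_one_neg (k s : ℕ) :
    (poch 1 k).eval (-((s : ℝ) + 1)) = 0 ↔ s < k := by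
  rw [poch, eval_comp]
  simp only [eval_add, eval_X, eval_C]
  rw [ascPochhammer_eval_eq_zero_iff]
  constructor
  · rintro ⟨l, hl, h⟩
    have : (l : ℝ) = s := by linarith
    rwa [← Nat.cast_injective this]
  · intro h
    exact ⟨s, h, by ring⟩

/-- The factor `(x + 1)_α` vanishes at these points, so `M` plays no role there and only the first
Pochhammer symbol decides. -/
lemma eval_calR_neg_eq_zero_iff {α : ℕ} (M : Matrix (Fin m) (Fin m) ℝ) (k : Fin m) {s : ℕ}
    (hs : s < α) : (calR α M k).eval (-((s : ℝ) + 1)) = 0 ↔ s < m - 1 - k := by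
  rw [calR]
  simp only [eval_add, eval_mul, eval_C, (eval_poch_one_neg α s).mpr hs, mul_zero, zero_mul,
    add_zero]
  rw [mul_eq_zero, eval_poch_one_neg, or_iff_right]
  positivity

/-- No nonzero polynomial is right orthogonal to all polynomials of degree less than `n` if it
has itself degree less than `n` and there are left orthogonal polynomials. -/
lemma HasLeftOrthogonalPolynomials.eq_zero {α : ℕ} {M : Matrix (Fin m) (Fin m) ℝ}
    (h : HasLeftOrthogonalPolynomials (sobolevForm α M)) {n : ℕ} {q : ℝ[X]} (hq : q.degree < n)
    (horth : ∀ k < n, sobolevBilin α M (X ^ k) q = 0) : q = 0 := by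
  by_contra hq0
  obtain ⟨p, hp⟩ := h
  obtain ⟨hd, ho, hn⟩ := hp q.natDegree
  have hkn : q.natDegree < n := (natDegree_lt_iff_degree_lt hq0).mpr hq
  have hp0 : p q.natDegree ≠ 0 := fun h0 => by simp [h0] at hd
  have hpd : (p q.natDegree).natDegree = q.natDegree := natDegree_eq_of_degree_eq_some hd
  have h1 : sobolevBilin α M (p q.natDegree) q = 0 := by
    conv_lhs => rw [(p q.natDegree).as_sum_range_C_mul_X_pow]
    rw [map_sum, LinearMap.sum_apply]
    refine Finset.sum_eq_zero fun k hk => ?_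
    rw [← smul_eq_C_mul, map_smul, LinearMap.smul_apply, horth k, smul_zero]
    rw [Finset.mem_range, hpd] at hk
    omega
  -- With this `c` the leading terms of `q` and `c p` cancel, so `p` is orthogonal to `q - c p`;
  -- being orthogonal to `q` too, it would satisfy `⟨p, p⟩ = 0`.
  set c := q.leadingCoeff / (p q.natDegree).leadingCoeff with hc
  have hlc : (p q.natDegree).leadingCoeff ≠ 0 := leadingCoeff_ne_zero.mpr hp0
  have hc0 : c ≠ 0 := div_ne_zero (leadingCoeff_ne_zero.mpr hq0) hlc
  have h2 : (q - c • p q.natDegree).degree < (q.natDegree : WithBot ℕ) := by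
    rw [← degree_eq_natDegree hq0]
    refine degree_sub_lt_left ?_ hq0 ?_
    · rw [degree_smul_of_smul_regular _ (IsSMulRegular.of_ne_zero hc0), hd, degree_eq_natDegree hq0]
    · rw [smul_eq_C_mul, leadingCoeff_mul, leadingCoeff_C, hc, div_mul_cancel₀ _ hlc]
  have h3 := ho _ h2
  rw [← sobolevBilin_apply, map_sub, h1, map_smul, zero_sub, neg_eq_zero, smul_eq_mul,
    sobolevBilin_apply] at h3
  exact mul_ne_zero hc0 hn h3

/-- A kernel vector `β` of the matrix at `n` defines a combination `q` of lower Laguerre polynomials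
with `⟨x^k, q⟩ = 0` for `k < n`, hence `q = 0`. This kills `β j` for `j < n` by distinctness of
degrees. For `j ≥ n` the Laguerre polynomials are zero and say nothing; the triangular zero pattern
of the `ℛ_k` at negative integers is used instead. -/
lemma eval_casorati_ne_zero {α : ℕ} (hα : m ≤ α) {M : Matrix (Fin m) (Fin m) ℝ}
    (h : HasLeftOrthogonalPolynomials (sobolevForm α M)) (n : ℕ) :
    (casorati α M).eval (n : ℝ) ≠ 0 := by
  intro h0
  rw [casorati_eq, eval_det_casoratiMatrix] at h0
  obtain ⟨β, hβ, hβ'⟩ := Matrix.exists_mulVec_eq_zero_iff.mpr h0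
  have hR : ∀ k : Fin m, ∑ j : Fin m, (calR α M k).eval ((n : ℝ) - (j + 1)) * β j = 0 :=
    fun k => congrFun hβ' k
  have hval : ∀ (k j : Fin m), n ≤ j →
      ((calR α M k).eval ((n : ℝ) - (j + 1)) = 0 ↔ (j : ℕ) - n < m - 1 - k) := by
    intro k j hj
    have hj' := j.2
    rw [← eval_calR_neg_eq_zero_iff M k (show (j : ℕ) - n < α by omega), Nat.cast_sub hj]
    have : (n : ℝ) - (j + 1) = -((j : ℝ) - n + 1) := by ring
    rw [this]
  set q : ℝ[X] := ∑ j : Fin m, β j • laguerreSub α n (j + 1) with hq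
  have hdeg : q.degree < n := by
    rw [degree_lt_iff_coeff_zero]
    intro i hi
    rw [hq, finsetSum_coeff]
    refine Finset.sum_eq_zero fun j _ => ?_
    rw [coeff_smul, laguerreSub]
    split_ifs with hj
    · rw [coeff_eq_zero_of_natDegree_lt ((degree_laguerre _ _).trans_lt (by omega)), smul_zero]
    · simp
  have horth : ∀ k < n, sobolevBilin α M (X ^ k) q = 0 := by
    intro k hk
    rw [hq, map_sum]
    rcases lt_or_ge k m with hkm | hkm
    · rw [← hR ⟨k, hkm⟩]
      refine Finset.sum_congr rfl fun j _ => ?_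
      have hj := j.2
      rw [map_smul, laguerreSub, smul_eq_mul, mul_comm]
      congr 1
      split_ifs with hjn
      · rw [sobolevBilin_X_pow_laguerre hα M ⟨k, hkm⟩, Nat.cast_sub hjn]
        push_cast; rfl
      -- For `j ≥ n` the matrix entry itself must vanish; it does, because `k < n` gives `j - n ≤ m
      -- - 1 - n < m - 1 - k`.
      · rw [map_zero, eq_comm, hval _ _ (by omega)]
        simp only
        omega
    · refine Finset.sum_eq_zero fun j _ => ?_
      have hj := j.2
      rw [map_smul, laguerreSub]
      split_ifs with hjn
      · rw [sobolevBilin_X_pow_laguerre_eq_zero hα M hkm (by omega), smul_zero]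
      · rw [map_zero, smul_zero]
  have hq0 : q = 0 := h.eq_zero hdeg horth
  obtain ⟨j₀, hj₀⟩ := Function.ne_iff.mp hβ
  by_cases hsmall : ∃ j : Fin m, (j : ℕ) < n ∧ β j ≠ 0
  · obtain ⟨j₁, hj₁⟩ := hsmall
    obtain ⟨j, hj, hmin⟩ := Finset.exists_min_image
      (Finset.univ.filter fun j : Fin m => (j : ℕ) < n ∧ β j ≠ 0) (fun j => (j : ℕ))
      ⟨j₁, by simpa using hj₁⟩
    obtain ⟨hjn, hβj⟩ := (Finset.mem_filter.mp hj).2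
    have h1 := congrArg (fun p => coeff p (n - (j + 1))) hq0
    simp only [hq, finsetSum_coeff, coeff_smul, smul_eq_mul, coeff_zero] at h1
    rw [Finset.sum_eq_single j] at h1
    · rw [laguerreSub, if_pos (show (j : ℕ) + 1 ≤ n from hjn)] at h1
      exact mul_ne_zero hβj (coeff_laguerre_self_ne_zero _ _) h1
    · intro i _ hij
      have hij' : (i : ℕ) ≠ j := fun h => hij (Fin.ext h)
      by_cases hi : (i : ℕ) < n ∧ β i ≠ 0
      · have h2 := hmin i (by simpa using hi)
        rw [laguerreSub, if_pos (show (i : ℕ) + 1 ≤ n from hi.1),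
          coeff_eq_zero_of_natDegree_lt ((degree_laguerre _ _).trans_lt (by omega)), mul_zero]
      · rw [not_and_or, not_not] at hi
        rcases hi with hi | hi
        · rw [laguerreSub, if_neg (by omega), coeff_zero, mul_zero]
        · rw [hi, zero_mul]
    · simp
  · push Not at hsmall
    obtain ⟨j, hj, hmax⟩ := Finset.exists_max_image
      (Finset.univ.filter fun j : Fin m => β j ≠ 0) (fun j => (j : ℕ)) ⟨j₀, by simpa using hj₀⟩
    have hβj := (Finset.mem_filter.mp hj).2
    have hnj : n ≤ j := by
      by_contra hlt
      exact hβj (hsmall j (by omega))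
    have hjm := j.2
    -- In this row the entry at the last support index `j` is nonzero, while all entries at indices
    -- from `n` up to `j - 1` vanish.
    have h1 := hR ⟨m - 1 - (j - n), by omega⟩
    rw [Finset.sum_eq_single j] at h1
    · rcases mul_eq_zero.mp h1 with h1 | h1
      · rw [hval _ _ hnj] at h1
        simp only at h1
        omega
      · exact hβj h1
    · intro i _ hij
      have hij' : (i : ℕ) ≠ j := fun h => hij (Fin.ext h)
      by_cases hi : β i = 0
      · rw [hi, mul_zero]
      · have h2 := hmax i (by simpa using hi)
        have hni : n ≤ i := by
          by_contra hlt
          exact hi (hsmall i (by omega))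
        rw [(hval _ _ hni).mpr (by simp only; omega), zero_mul]
    · simp

end Orthogonality

section OrderOfSobolevOp

/-! ### The difference equation -/

lemma sub_comp_eq_taylor (P : ℝ[X]) : P - P.comp (X - 1) = P - taylor (-1) P := by
  rw [taylor_apply, C_neg, C_1, sub_eq_add_neg X]

lemma zcoeff_natDegree_ne_zero {p : ℝ[X]} (hp : p ≠ 0) : zcoeff p p.natDegree ≠ 0 := by
  rw [zcoeff_natCast]; exact leadingCoeff_ne_zero.mpr hp

lemma natDegree_eq_of_degLE {p : ℝ[X]} {d : ℤ} (h : DegLE p d) (h0 : zcoeff p d ≠ 0) :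
    p ≠ 0 ∧ (p.natDegree : ℤ) = d := by
  have hd : 0 ≤ d := by
    by_contra hd
    exact h0 (zcoeff_of_neg p (not_le.mp hd))
  lift d to ℕ using hd
  rw [zcoeff_natCast] at h0
  refine ⟨fun hp => h0 (by simp [hp]), ?_⟩
  have h1 := degLE_natCast_iff.mp h
  have h2 := le_natDegree_of_ne_zero h0
  omega

lemma exists_sub_comp_eq (Q : ℝ[X]) : ∃ P : ℝ[X], P - P.comp (X - 1) = Q := by
  suffices h : ∀ (n : ℕ) (Q : ℝ[X]), DegLE Q ((n : ℤ) - 1) → ∃ P : ℝ[X], P - taylor (-1) P = Q by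
    obtain ⟨P, hP⟩ := h (Q.natDegree + 1) Q ((degLE_natDegree Q).mono (by push_cast; omega))
    exact ⟨P, by rw [sub_comp_eq_taylor, hP]⟩
  intro n
  induction n with
  | zero => exact fun Q hQ => ⟨0, by rw [hQ.eq_zero (by norm_num)]; simp⟩
  | succ n ih =>
    intro Q hQ
    have hX : DegLE ((X : ℝ[X]) ^ (n + 1)) ((n + 1 : ℕ) : ℤ) :=
      degLE_natCast_iff.mpr (natDegree_X_pow_le _)
    obtain ⟨h1, h2⟩ := hX.sub_taylor (-1)
    have e : ((n + 1 : ℕ) : ℤ) - 1 = (n : ℕ) := by push_cast; ring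
    rw [e] at h1 h2 hQ
    rw [zcoeff_natCast, zcoeff_natCast, coeff_X_pow_self] at h2
    set T : ℝ[X] := X ^ (n + 1) - taylor (-1) (X ^ (n + 1)) with hT
    -- The difference of `X ^ (n + 1)` has leading coefficient `n + 1`, so subtracting `c • T`
    -- removes the top term of `Q`.
    set c : ℝ := Q.coeff n / (n + 1) with hc
    obtain ⟨P, hP⟩ := ih (Q - c • T) fun i hi => by
      rcases eq_or_lt_of_le (show n ≤ i by omega) with rfl | hlt
      · rw [coeff_sub, coeff_smul, h2, hc, smul_eq_mul]
        have : (n : ℝ) + 1 ≠ 0 := by positivity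
        push_cast
        field_simp
        ring
      · exact (hQ.sub (h1.smul c)) i (by exact_mod_cast hlt)
    refine ⟨P + c • X ^ (n + 1), ?_⟩
    rw [map_add, LinearMap.map_smul, add_sub_add_comm, hP, ← smul_sub, ← hT, sub_add_cancel]

lemma natDegree_of_sub_comp_eq {P Q : ℝ[X]} (h : P - P.comp (X - 1) = Q) (hQ : Q ≠ 0) :
    P.natDegree = Q.natDegree + 1 := by
  rw [sub_comp_eq_taylor] at h
  have hP : P ≠ 0 := fun h0 => hQ (by rw [← h, h0]; simp)
  obtain ⟨h1, h2⟩ := (degLE_natDegree P).sub_taylor (-1)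
  rw [h] at h1 h2
  have h0 : P.natDegree ≠ 0 := fun h0 => hQ (h1.eq_zero (by omega))
  have h3 := (natDegree_eq_of_degLE h1 (by
    rw [h2]
    refine mul_ne_zero (mul_ne_zero (by norm_num) ?_) (zcoeff_natDegree_ne_zero hP)
    exact_mod_cast h0)).2
  omega

/-! ### The order of the operator -/

variable {m : ℕ}

lemma casorati_natDegree {α : ℕ} (hα : m ≤ α) (M : Matrix (Fin m) (Fin m) ℝ) :
    casorati α M ≠ 0 ∧ ((casorati α M).natDegree : ℤ) = awr α M := by
  obtain ⟨A, a, hA, ha, h1, h2, h3⟩ := exists_basis_calR hα M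
  obtain ⟨h4, h5⟩ := degLE_det_casoratiMatrix _ ha h1 h2
  rw [det_casoratiMatrix_mul, h3, ← casorati_eq] at h4 h5
  obtain ⟨h6, h7⟩ := natDegree_eq_of_degLE h4 h5
  rw [natDegree_C_mul hA] at h7
  exact ⟨right_ne_zero_of_mul h6, h7⟩

lemma natDegree_of_sub_comp_eq_mul_casorati {α : ℕ} (hα : m ≤ α) (M : Matrix (Fin m) (Fin m) ℝ)
    {S P : ℝ[X]} (hS : S ≠ 0) (hP : P - P.comp (X - 1) = S * casorati α M) :
    (P.natDegree : ℤ) = S.natDegree + awr α M + 1 := by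
  obtain ⟨h1, h2⟩ := casorati_natDegree hα M
  rw [natDegree_of_sub_comp_eq hP (mul_ne_zero hS h1), natDegree_mul hS h1, ← h2]
  push_cast; rfl

/-- For the given `ℛ_l` the bound of `degLE_minorSum` may exceed the degree of `P`, since it uses
the sum of their degrees. In the basis of distinct degrees that sum yields exactly `awr`, and each
product stays at or below `deg P - 1`. -/
lemma sobolevOp_isDiffOpOfOrder {α : ℕ} (hα : m ≤ α) (M : Matrix (Fin m) (Fin m) ℝ)
    {S P : ℝ[X]} (hS : S ≠ 0) (hP : P - P.comp (X - 1) = S * casorati α M) :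
    IsDiffOpOfOrder (sobolevOp α M S P) (2 * P.natDegree) := by
  have hdeg := natDegree_of_sub_comp_eq_mul_casorati hα M hS hP
  have hP0 : P ≠ 0 := fun h0 => mul_ne_zero hS (casorati_natDegree hα M).1 (by
    rw [← hP, h0]; simp)
  obtain ⟨A, a, hA, ha, h1, h2, h3⟩ := exists_basis_calR hα M
  set R : Fin m → ℝ[X] := fun i => ∑ l, A i l • calR α M l with hR
  have hop : sobolevOp α M S P = aeval (laguerreOp α) P +
      ∑ i, aeval (laguerreOp α) (A.det⁻¹ • minorSum R S i) * derivative *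
        aeval (laguerreOp α) (R i) := by
    rw [sobolevOp_eq, kernelOp]
    congr 1
    simp only [map_smul, smul_mul_assoc]
    rw [← Finset.smul_sum, sum_minorSum_mul, smul_smul, inv_mul_cancel₀ hA, one_smul]
  rw [hop]
  refine isDiffOpOfOrder_aeval_add_sum α hP0 _ _ _ fun i _ => ?_
  by_cases h0 : A.det⁻¹ • minorSum R S i = 0
  · exact Or.inl h0
  right
  have h4 := (degLE_minorSum R h1 (degLE_natDegree S) i).smul A.det⁻¹
  rw [h3] at h4
  have h5 := (natDegree_eq_of_degLE (h1 i) (h2 i)).2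
  have h6 : ((A.det⁻¹ • minorSum R S i).natDegree : ℤ) ≤ S.natDegree + awr α M - a i := by
    by_contra hlt
    exact leadingCoeff_ne_zero.mpr h0 (h4 _ (not_le.mp hlt))
  have h7 : ((R i).natDegree : ℤ) = a i := h5
  omega

end OrderOfSobolevOp

end LaguerreSobolev

end

/-! ### The main theorem -/

theorem theorem2 (m : ℕ) (hm : 1 ≤ m) (α : ℕ) (hα : m ≤ α) (M : Matrix (Fin m) (Fin m) ℝ)
    (h : LaguerreSobolev.HasLeftOrthogonalPolynomials (LaguerreSobolev.sobolevForm α M) ∨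
      ∀ n : ℕ, (LaguerreSobolev.casorati α M).eval (n : ℝ) ≠ 0) :
    -- for every `S` the difference equation for `P_S` has a polynomial solution
    (∀ S : ℝ[X], ∃ P : ℝ[X], P - P.comp (X - 1) = S * LaguerreSobolev.casorati α M) ∧
    -- for every `S` and every solution `P = P_S` (they differ by additive constants)
    (∀ S P : ℝ[X], P - P.comp (X - 1) = S * LaguerreSobolev.casorati α M →
      (∀ n : ℕ, (LaguerreSobolev.sobolevOp α M S P).HasEigenvector (P.eval (n : ℝ))
        (LaguerreSobolev.sobolevPoly α M n)) ∧
      (S ≠ 0 → ∃ r : ℕ, (r : ℤ) = 2 * (S.natDegree + LaguerreSobolev.awr α M + 1) ∧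
        LaguerreSobolev.IsDiffOpOfOrder (LaguerreSobolev.sobolevOp α M S P) r)) ∧
    -- the minimal (positive) order of the operators having all `q_n` as eigenfunctions
    (∃ d : ℕ, IsLeast {k : ℕ | 0 < k ∧ ∃ D : Module.End ℝ ℝ[X],
          LaguerreSobolev.IsDiffOpOfOrder D k ∧
          ∀ n : ℕ, ∃ μ : ℝ, D.HasEigenvector μ (LaguerreSobolev.sobolevPoly α M n)} d ∧
        (d : ℤ) ≤ 2 * (LaguerreSobolev.awr α M + 1)) := by
  have hΩ : ∀ n : ℕ, (LaguerreSobolev.casorati α M).eval (n : ℝ) ≠ 0 :=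
    h.elim (fun h => LaguerreSobolev.eval_casorati_ne_zero hα h) id
  have hord : ∀ S P : ℝ[X], P - P.comp (X - 1) = S * LaguerreSobolev.casorati α M →
      S ≠ 0 → ((2 * P.natDegree : ℕ) : ℤ) =
        2 * (S.natDegree + LaguerreSobolev.awr α M + 1) := fun S P hP hS => by
    push_cast
    rw [LaguerreSobolev.natDegree_of_sub_comp_eq_mul_casorati hα M hS hP]
  refine ⟨fun S => LaguerreSobolev.exists_sub_comp_eq _, fun S P hP =>
    ⟨fun n => LaguerreSobolev.sobolevOp_hasEigenvector α M hP n (hΩ n), fun hS =>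
      ⟨2 * P.natDegree, hord S P hP hS,
        LaguerreSobolev.sobolevOp_isDiffOpOfOrder hα M hS hP⟩⟩, ?_⟩
  -- The choice `S = 1` bounds the minimal order; the order is positive because `P` has degree one
  -- more than the nonzero `Ω`.
  obtain ⟨P, hP⟩ := LaguerreSobolev.exists_sub_comp_eq (1 * LaguerreSobolev.casorati α M)
  have hdeg : P.natDegree ≠ 0 := by
    have h0 := LaguerreSobolev.casorati_natDegree hα M
    rw [LaguerreSobolev.natDegree_of_sub_comp_eq hP (mul_ne_zero one_ne_zero h0.1)]
    exact Nat.succ_ne_zero _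
  have hmem : 2 * P.natDegree ∈ {k : ℕ | 0 < k ∧ ∃ D : Module.End ℝ ℝ[X],
      LaguerreSobolev.IsDiffOpOfOrder D k ∧
      ∀ n : ℕ, ∃ μ : ℝ, D.HasEigenvector μ (LaguerreSobolev.sobolevPoly α M n)} :=
    ⟨by omega, LaguerreSobolev.sobolevOp α M 1 P,
      LaguerreSobolev.sobolevOp_isDiffOpOfOrder hα M one_ne_zero hP,
      fun n => ⟨_, LaguerreSobolev.sobolevOp_hasEigenvector α M hP n (hΩ n)⟩⟩
  refine ⟨sInf _, ⟨Nat.sInf_mem ⟨_, hmem⟩, fun k hk => Nat.sInf_le hk⟩, ?_⟩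
  have h1 := Nat.sInf_le hmem
  have h2 := hord 1 P hP one_ne_zero
  rw [natDegree_one, Nat.cast_zero, zero_add] at h2
  rw [← h2]
  exact_mod_cast h1
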